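/- Let $M$ be a smooth (finite-dimensional, Hausdorff, real) manifold and let $(E,q,[\![\,,\,]\!])$ be a Lie algebroid over $M$: $E\to M$ is a smooth real vector bundle of finite rank, $q:E\to TM$ is a vector bundle map over $M$, and $[\![\,,\,]\!]$ is a Lie bracket on $\Gamma E$ with $[\![A,fB]\!]=f[\![A,B]\!]+qA(f)\,B$ for $A,B\in\Gamma E$, $f\in C^\infty(M)$. Let $\nabla$ be a linear connection on $E$. (a) There is exactly one derivation $D$ of degree $1$ of $\Gamma(\Lambda^\bullet E^*)$, that is, one family of $\mathbb{R}$-linear maps $D:\Gamma(\Lambda^pE^*)\to\Gamma(\Lambda^{p+1}E^*)$ with $D(\alpha\wedge\beta)=D\alpha\wedge\beta+(-1)^{p}\alpha\wedge D\beta$ for $\alpha\in\Gamma(\Lambda^pE^*)$, such that $$Df(A)=qA(f),\qquad D\alpha(A,B)=qA(\alpha(B))-qB(\alpha(A))-\alpha([\![A,B]\!])$$ for all $f\in C^\infty(M)$, $\alpha\in\Gamma(E^*)$, $A,B\in\Gamma E$ (the differential of the Lie algebroid). (b) There is a tensor field $L^\nabla\in\Gamma(\Lambda^2E^*\otimes E)$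 with $$L^\nabla(A,B)=\nabla_{qA}B-\nabla_{qB}A-[\![A,B]\!]\qquad(A,B\in\Gamma E),$$ the torsion $\delta_AB-\delta_BA-[\![A,B]\!]$ of the $E$-connection $\delta_AB=\nabla_{qA}B$ on $E$, and $$D=\nabla_q+\imath_{L^\nabla}\quad\text{on }\Gamma(\Lambda^pE^*)\text{ for all }p\ge 0 .$$ Here $\nabla_q$ is the operator $$(\nabla_q\omega)(A_0,\dots,A_p)=\sum_{i=0}^p(-1)^i(\nabla_{qA_i}\omega)(A_0,\dots,\widehat{A_i},\dots,A_p),$$ $$(\nabla_X\omega)(B_1,\dots,B_p)=X(\omega(B_1,\dots,B_p))-\sum_{j}\omega(B_1,\dots,\nabla_XB_j,\dots,B_p),$$ and $\imath_L$ is the insertion $$(\imath_L\omega)(A_0,\dots,A_p)=\sum_{i<j}(-1)^{i+j+1}\omega(L(A_i,A_j),A_0,\dots,\widehat{A_i},\dots,\widehat{A_j},\dots,A_p),$$ which is zero on functions. -/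

import Mathlib

open Bundle Function
open scoped Manifold ContDiff Topology

noncomputable section

set_option linter.unusedSectionVars false

namespace LieAlgd

variable {E : Type*} [NormedAddCommGroup E] [NormedSpace ℝ E]
  {H : Type*} [TopologicalSpace H] (I : ModelWithCorners ℝ E H)
  {M : Type*} [TopologicalSpace M] [ChartedSpace H M]
  (F : Type*) [NormedAddCommGroup F] [NormedSpace ℝ F]
  (V : M → Type*) [TopologicalSpace (TotalSpace F V)]
  [∀ x, AddCommGroup (V x)] [∀ x, Module ℝ (V x)] [∀ x, TopologicalSpace (V x)]
  [FiberBundle F V]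

/-! ### Exterior forms on a vector bundle -/

/-- `Γ(Λᵖ V*)`: families of alternating `p`-linear forms on the fibres of `V` which are smooth, that
is, which give a smooth function when evaluated on smooth sections of `V`. -/
def EForm (p : ℕ) : Submodule ℝ (∀ x : M, V x [⋀^Fin p]→ₗ[ℝ] ℝ) where
  carrier := {η | ∀ A : Fin p → Cₛ^∞⟮I; F, V⟯,
    ContMDiff I 𝓘(ℝ, ℝ) ∞ fun x => η x fun i => A i x}
  add_mem' h h' A := (h A).add (h' A)
  zero_mem' _ := contMDiff_const
  smul_mem' _ _ h A := contMDiff_const.mul (h A)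

/-- `Γ(Λᵏ V* ⊗ V)`: families of alternating `k`-linear maps `(V x)ᵏ → V x` which are smooth, that
is, which give a smooth section of `V` when evaluated on smooth sections of `V`. -/
structure EValuedForm (k : ℕ) where
  toFun : ∀ x : M, V x [⋀^Fin k]→ₗ[ℝ] V x
  smooth : ∀ A : Fin k → Cₛ^∞⟮I; F, V⟯,
    ContMDiff I (I.prod 𝓘(ℝ, F)) ∞ fun x => (⟨x, toFun x fun i => A i x⟩ : TotalSpace F V)

variable {I F V}

/-- The value `η(A₁, …, Aₚ)` as a smooth function. -/
def evalForm {p : ℕ} (η : EForm I F V p) (A : Fin p → Cₛ^∞⟮I; F, V⟯) : C^∞⟮I, M; ℝ⟯ :=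
  ⟨fun x => η.1 x fun i => A i x, η.2 A⟩

/-- The value `L(A₁, …, Aₖ)` as a smooth section. -/
def EValuedForm.eval {k : ℕ} (L : EValuedForm I F V k) (A : Fin k → Cₛ^∞⟮I; F, V⟯) :
    Cₛ^∞⟮I; F, V⟯ :=
  ⟨fun x => L.toFun x fun i => A i x, L.smooth A⟩

/-- A smooth function as a form of degree `0`. -/
def ofFunction (f : C^∞⟮I, M; ℝ⟯) : EForm I F V 0 :=
  ⟨fun x => AlternatingMap.constOfIsEmpty ℝ (V x) (Fin 0) (f x), fun _ => f.contMDiff⟩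

/-- Transport of a form along an equality of degrees. -/
def castDeg {p k : ℕ} (h : p = k) (η : EForm I F V p) : EForm I F V k :=
  ⟨fun x => (η.1 x).domDomCongr (finCongr h), fun A => η.2 fun i => A (finCongr h i)⟩

/-- The exterior product of two alternating forms on a vector space,
`(α ∧ β)(v₁, …, v_{p+k}) = ∑ sgn(σ) α(v_{σ(1)}, …, v_{σ(p)}) β(v_{σ(p+1)}, …, v_{σ(p+k)})`,
the sum being over the `(p,k)`-shuffles. -/
def wedgeAlt {W : Type*} [AddCommGroup W] [Module ℝ W] {p k : ℕ}
    (α : W [⋀^Fin p]→ₗ[ℝ] ℝ) (β : W [⋀^Fin k]→ₗ[ℝ] ℝ) : W [⋀^Fin (p + k)]→ₗ[ℝ] ℝ :=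
  ((LinearMap.mul' ℝ ℝ).compAlternatingMap (α.domCoprod β)).domDomCongr finSumFinEquiv

theorem wedgeAlt_apply {W : Type*} [AddCommGroup W] [Module ℝ W] {p k : ℕ}
    (α : W [⋀^Fin p]→ₗ[ℝ] ℝ) (β : W [⋀^Fin k]→ₗ[ℝ] ℝ) (v : Fin (p + k) → W) :
    wedgeAlt α β v = ∑ σ : Equiv.Perm.ModSumCongr (Fin p) (Fin k),
      (Equiv.Perm.sign σ.out : ℤ) • (α (fun i => v (finSumFinEquiv (σ.out (Sum.inl i)))) *
        β (fun i => v (finSumFinEquiv (σ.out (Sum.inr i))))) := by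
  simp only [wedgeAlt, AlternatingMap.domDomCongr_apply, LinearMap.compAlternatingMap_apply,
    AlternatingMap.domCoprod_apply, sum_apply, map_sum]
  refine Finset.sum_congr rfl fun σ _ => ?_
  conv_lhs => rw [← Quotient.out_eq' σ]
  rw [AlternatingMap.domCoprod.summand_mk'', Units.smul_def]
  exact map_zsmul (LinearMap.mul' ℝ ℝ) _
    (MultilinearMap.domDomCongr σ.out ((α : MultilinearMap ℝ (fun _ => W) ℝ).domCoprod
      (β : MultilinearMap ℝ (fun _ => W) ℝ)) (v ∘ finSumFinEquiv))

/-- The exterior product of forms. -/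
def wedge {p k : ℕ} (α : EForm I F V p) (β : EForm I F V k) : EForm I F V (p + k) :=
  ⟨fun x => wedgeAlt (α.1 x) (β.1 x), fun A => by
    simp only [wedgeAlt_apply]
    refine contMDiff_finsetSum fun σ _ => ?_
    have h := (α.2 fun i => A (finSumFinEquiv (σ.out (Sum.inl i)))).mul
      (β.2 fun i => A (finSumFinEquiv (σ.out (Sum.inr i))))
    simp only [zsmul_eq_mul]
    exact contMDiff_const.mul h⟩

variable (I F V) in
/-- A derivation of degree `1` of `Γ(Λ V*)`: an `ℝ`-linear operator raising the degree by one, with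
`D(α ∧ β) = Dα ∧ β + (-1)ᵖ α ∧ Dβ` for `α` of degree `p`. -/
structure DerivationOne where
  toFun : ∀ p : ℕ, EForm I F V p →ₗ[ℝ] EForm I F V (p + 1)
  leibniz : ∀ (p k : ℕ) (α : EForm I F V p) (β : EForm I F V k),
    toFun (p + k) (wedge α β) =
      castDeg (Nat.add_right_comm p 1 k) (wedge (toFun p α) β) + (-1 : ℝ) ^ p • wedge α (toFun k β)

variable [VectorBundle ℝ F V]

/-- The product `f A` of a smooth function and a smooth section. -/
def fmul (f : C^∞⟮I, M; ℝ⟯) (A : Cₛ^∞⟮I; F, V⟯) : Cₛ^∞⟮I; F, V⟯ :=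
  ⟨fun x => f x • A x, f.contMDiff.smul_section A.contMDiff⟩

variable [IsManifold I ∞ M]

/-! ### Lie algebroids -/

variable (I F V) in
/-- A vector bundle map `V → TM` over the identity of `M`. -/
structure BundleMapToTangent where
  toFun : ∀ x : M, V x →L[ℝ] TangentSpace I x
  smooth : ContMDiff I (I.prod 𝓘(ℝ, F →L[ℝ] E)) ∞ fun x =>
    (TotalSpace.mk' (F →L[ℝ] E) x (toFun x) :
      TotalSpace (F →L[ℝ] E) fun x : M => V x →L[ℝ] TangentSpace I x)

/-- The function `(qA)(f)`. -/
def anchorDeriv (q : BundleMapToTangent I F V) (A : Cₛ^∞⟮I; F, V⟯) (f : M → ℝ) (x : M) : ℝ :=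
  mvfderiv I f x (q.toFun x (A x))

variable (I F V) in
/-- A Lie algebroid structure on the vector bundle `V`: an anchor `V → TM` and a Lie bracket on the
smooth sections of `V` satisfying the Leibniz rule. -/
structure LieAlgebroid where
  anchor : BundleMapToTangent I F V
  bracket : Cₛ^∞⟮I; F, V⟯ →ₗ[ℝ] Cₛ^∞⟮I; F, V⟯ →ₗ[ℝ] Cₛ^∞⟮I; F, V⟯
  bracket_self : ∀ A, bracket A A = 0
  jacobi : ∀ A B C,
    bracket A (bracket B C) + bracket B (bracket C A) + bracket C (bracket A B) = 0
  leibniz : ∀ (A B : Cₛ^∞⟮I; F, V⟯) (f : C^∞⟮I, M; ℝ⟯) (x : M),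
    bracket A (fmul f B) x = f x • bracket A B x + anchorDeriv anchor A f x • B x

/-- `D` is the differential of the Lie algebroid: on functions and on forms of degree `1` it is
given by `Df(A) = qA(f)` and `Dα(A, B) = qA(α(B)) - qB(α(A)) - α([A, B])`. -/
structure LieAlgebroid.IsDifferential (𝔞 : LieAlgebroid I F V) (D : DerivationOne I F V) :
    Prop where
  function : ∀ (f : C^∞⟮I, M; ℝ⟯) (A : Cₛ^∞⟮I; F, V⟯) (x : M),
    evalForm (D.toFun 0 (ofFunction f)) ![A] x = anchorDeriv 𝔞.anchor A f x
  oneForm : ∀ (α : EForm I F V 1) (A B : Cₛ^∞⟮I; F, V⟯) (x : M),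
    evalForm (D.toFun 1 α) ![A, B] x =
      anchorDeriv 𝔞.anchor A (evalForm α ![B]) x - anchorDeriv 𝔞.anchor B (evalForm α ![A]) x
        - evalForm α ![𝔞.bracket A B] x

/-- A connection of the Lie algebroid `𝔞` on its own vector bundle. -/
structure EConnection (𝔞 : LieAlgebroid I F V) where
  toFun : Cₛ^∞⟮I; F, V⟯ →ₗ[ℝ] Cₛ^∞⟮I; F, V⟯ →ₗ[ℝ] Cₛ^∞⟮I; F, V⟯
  fmul_left : ∀ f A B, toFun (fmul f A) B = fmul f (toFun A B)
  leibniz : ∀ (A B : Cₛ^∞⟮I; F, V⟯) (f : C^∞⟮I, M; ℝ⟯) (x : M),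
    toFun A (fmul f B) x = anchorDeriv 𝔞.anchor A f x • B x + f x • toFun A B x

/-- The torsion `δ_A B - δ_B A - [A, B]`. -/
def EConnection.torsion {𝔞 : LieAlgebroid I F V} (δ : EConnection 𝔞) (A B : Cₛ^∞⟮I; F, V⟯) :
    Cₛ^∞⟮I; F, V⟯ :=
  δ.toFun A B - δ.toFun B A - 𝔞.bracket A B

/-! ### Linear connections -/

variable [∀ x, IsTopologicalAddGroup (V x)] [∀ x, ContinuousSMul ℝ (V x)]
  [ContMDiffVectorBundle ∞ F V I]

theorem contMDiff_anchor (q : BundleMapToTangent I F V) (A : Cₛ^∞⟮I; F, V⟯) :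
    ContMDiff I I.tangent ∞ fun x => (⟨x, q.toFun x (A x)⟩ : TangentBundle I M) :=
  ContMDiff.clm_bundle_apply q.smooth A.contMDiff

theorem contMDiff_anchorDeriv (q : BundleMapToTangent I F V) (A : Cₛ^∞⟮I; F, V⟯)
    (f : C^∞⟮I, M; ℝ⟯) : ContMDiff I 𝓘(ℝ, ℝ) ∞ (anchorDeriv q A f) := by
  have h := (f.contMDiff.contMDiff_tangentMap (m := ∞) (by simp)).comp (contMDiff_anchor q A)
  have h1 := contMDiff_tangentBundleModelSpaceHomeomorph (I := 𝓘(ℝ, ℝ)) (n := ∞)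
  have h2 : ContMDiff (𝓘(ℝ, ℝ).prod 𝓘(ℝ, ℝ)) 𝓘(ℝ, ℝ) ∞ (fun v : ModelProd ℝ ℝ => v.2) := by
    have h3 := contMDiff_snd (I := 𝓘(ℝ, ℝ)) (J := 𝓘(ℝ, ℝ)) (M := ℝ) (N := ℝ) (n := ∞)
    rw [chartedSpaceSelf_prod] at h3
    exact h3
  exact h2.comp (h1.comp h)

/-- The smooth section `∇_{qA} B`. -/
def covAlong (cov : CovariantDerivative I F V) [cov.ContMDiffCovariantDerivative ∞]
    (q : BundleMapToTangent I F V) (A B : Cₛ^∞⟮I; F, V⟯) : Cₛ^∞⟮I; F, V⟯ :=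
  ⟨fun x => cov B x (q.toFun x (A x)), by
    have h := (CovariantDerivative.ContMDiffCovariantDerivative.contMDiff (cov := cov) (k := ∞)).contMDiff
      (σ := B) (by simpa using B.contMDiff.contMDiffOn)
    exact ContMDiff.clm_bundle_apply (contMDiffOn_univ.1 h) (contMDiff_anchor q A)⟩

/-- The connection `δ_A B = ∇_{qA} B` of the Lie algebroid induced by the linear connection `∇`. -/
def inducedConnection (𝔞 : LieAlgebroid I F V) (cov : CovariantDerivative I F V)
    [cov.ContMDiffCovariantDerivative ∞] : EConnection 𝔞 where
  toFun := LinearMap.mk₂ ℝ (covAlong cov 𝔞.anchor)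
    (fun A A' B => by ext x; simp [covAlong])
    (fun c A B => by ext x; simp [covAlong])
    (fun A B B' => by
      ext x
      simp [covAlong, cov.isCovariantDerivativeOnUniv.add B.mdifferentiableAt B'.mdifferentiableAt])
    (fun c A B => by
      ext x
      simp [covAlong, cov.isCovariantDerivativeOnUniv.smul_const c B.mdifferentiableAt])
  fmul_left f A B := by ext x; simp [covAlong, fmul]
  leibniz A B f x := by
    have h := cov.isCovariantDerivativeOnUniv.leibniz (B.mdifferentiableAt (x := x))
      (f.mdifferentiableAt (x := x))
    have h' := congrArg (fun L => L (𝔞.anchor.toFun x (A x))) h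
    simp only [add_apply, smul_apply, ContinuousLinearMap.smulRight_apply] at h'
    exact h'.trans (add_comm _ _)

variable [FiniteDimensional ℝ E] [FiniteDimensional ℝ F] [T2Space M]

theorem exists_section_eventuallyEq {x : M} {s : Set M} (hs : s ∈ 𝓝 x) {σ : ∀ y, V y}
    (hσ : CMDiff[s] ∞ (T% σ)) : ∃ A : Cₛ^∞⟮I; F, V⟯, ∀ᶠ y in 𝓝 x, σ y = A y := by
  obtain ⟨u, hus, hu, hxu⟩ := mem_nhds_iff.1 hs
  obtain ⟨f, -, hf⟩ := (SmoothBumpFunction.nhds_basis_tsupport (I := I) x).mem_iff.1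
    (hu.mem_nhds hxu)
  refine ⟨⟨(f : M → ℝ) • σ,
    ContMDiffOn.smul_section_of_tsupport f.contMDiff.contMDiffOn hu hf (hσ.mono hus)⟩, ?_⟩
  filter_upwards [f.eventuallyEq_one] with y hy
  simp [hy]

theorem mdifferentiableAt_form {p : ℕ} (η : EForm I F V p) {x : M} {B : Fin p → ∀ y, V y}
    (hB : ∀ i, MDifferentiableAt I (I.prod 𝓘(ℝ, F)) (fun y => (⟨y, B i y⟩ : TotalSpace F V)) x) : MDiffAt (fun y => η.1 y fun i => B i y) x := by
  have : ContMDiffVectorBundle 1 F V I := ContMDiffVectorBundle.of_le (n := ∞) (by simp)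
  let t := trivializationAt F V x
  let b := Module.finBasis ℝ F
  have hx : x ∈ t.baseSet := FiberBundle.mem_baseSet_trivializationAt' x
  choose A hA using fun k => exists_section_eventuallyEq (t.open_baseSet.mem_nhds hx)
    (t.contMDiffOn_localFrame_baseSet (I := I) ∞ b k)
  have hc : ∀ i k, MDiffAt (fun y => t.localFrameCoeff I b k y (B i y)) x := fun i k =>
    mdifferentiableAt_localFrameCoeff b hx (hB i) k
  have key : (fun y => η.1 y fun i => B i y) =ᶠ[𝓝 x]
      ∑ r : Fin p → Fin (Module.finrank ℝ F),
        (∏ i, fun y => t.localFrameCoeff I b (r i) y (B i y)) *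
          (fun y => η.1 y fun i => A (r i) y) := by
    have h1 : ∀ᶠ y in 𝓝 x, ∀ i, B i y = ∑ k, t.localFrameCoeff I b k y (B i y) • t.localFrame b k y :=
      Filter.eventually_all.2 fun i => t.eventually_eq_localFrame_sum_coeff_smul b hx
    filter_upwards [h1, Filter.eventually_all.2 hA] with y h1 h2
    conv_lhs => rw [show (fun i => B i y) = _ from funext h1]
    rw [← AlternatingMap.coe_multilinearMap, MultilinearMap.map_sum]
    simp only [h2, MultilinearMap.map_smul_univ, Finset.sum_apply, Pi.mul_apply, Finset.prod_apply,
      smul_eq_mul, AlternatingMap.coe_multilinearMap]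
  refine MDifferentiableAt.congr_of_eventuallyEq ?_ key
  refine MDifferentiableAt.sum fun r _ => ?_
  refine MDifferentiableAt.mul (MDifferentiableAt.prod fun i _ => hc i (r i)) ?_
  exact (η.2 fun i => A (r i)).mdifferentiableAt (by simp)

/-- The expression `X(η(B₁, …, Bₚ)) - ∑ⱼ η(B₁, …, ∇_X Bⱼ, …, Bₚ)` at `x`, where `X` has value `v`
at `x`. -/
def covFormAux (cov : CovariantDerivative I F V) {p : ℕ} (η : EForm I F V p) (x : M)
    (v : TangentSpace I x) (B : Fin p → ∀ y, V y) : ℝ :=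
  mvfderiv I (fun y => η.1 y fun i => B i y) x v
    - ∑ j, η.1 x (update (fun i => B i x) j (cov (B j) x v))

theorem covFormAux_tensorial (cov : CovariantDerivative I F V) {p : ℕ} (η : EForm I F V p) (x : M)
    (v : TangentSpace I x) {B : Fin p → ∀ y, V y} (hB : ∀ i, MDifferentiableAt I (I.prod 𝓘(ℝ, F)) (fun y => (⟨y, B i y⟩ : TotalSpace F V)) x) (i : Fin p) :
    TensorialAt I F (fun σ => covFormAux cov η x v (update B i σ)) x := by
  have hev : ∀ (σ : ∀ y, V y) y, (fun k => update B i σ k y) = update (fun k => B k y) i (σ y) := by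
    intro σ y; ext k
    by_cases h : k = i
    · subst h; simp
    · simp [h]
  have hd : ∀ {σ : ∀ y, V y}, MDiffAt (T% σ) x →
      MDiffAt (fun y => η.1 y (update (fun k => B k y) i (σ y))) x := by
    intro σ hσ
    simp only [← hev]
    refine mdifferentiableAt_form η fun k => ?_
    by_cases h : k = i
    · subst h; simpa using hσ
    · simpa [h] using hB k
  have hsum : ∀ σ : ∀ y, V y, covFormAux cov η x v (update B i σ) =
      mvfderiv I (fun y => η.1 y (update (fun k => B k y) i (σ y))) x v
      - (η.1 x (update (fun k => B k x) i (cov σ x v)) + ∑ j ∈ Finset.univ.erase i,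
        η.1 x (update (update (fun k => B k x) j (cov (B j) x v)) i (σ x))) := by
    intro σ
    rw [covFormAux, ← Finset.add_sum_erase _ _ (Finset.mem_univ i)]
    simp only [hev, update_self, update_idem]
    congr 2
    refine Finset.sum_congr rfl fun j hj => ?_
    have hj := Finset.ne_of_mem_erase hj
    rw [update_of_ne hj, update_comm hj]
  constructor
  · intro f σ hf hσ
    have e : (fun y => η.1 y (update (fun k => B k y) i ((f • σ) y))) =
        f • fun y => η.1 y (update (fun k => B k y) i (σ y)) := by
      ext y; simp
    rw [hsum, hsum, e, mvfderiv_smul hf (hd hσ), cov.isCovariantDerivativeOnUniv.leibniz hσ hf]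
    simp [← Finset.mul_sum]
    ring
  · intro σ τ hσ hτ
    have e : (fun y => η.1 y (update (fun k => B k y) i ((σ + τ) y))) =
        (fun y => η.1 y (update (fun k => B k y) i (σ y))) +
          fun y => η.1 y (update (fun k => B k y) i (τ y)) := by
      ext y; simp
    rw [hsum, hsum, hsum, e, mvfderiv_add (hd hσ) (hd hτ), cov.isCovariantDerivativeOnUniv.add hσ hτ]
    simp [Finset.sum_add_distrib]
    ring


theorem extend_update {x : M} {p : ℕ} (b : Fin p → V x) (i : Fin p) (u : V x) :
    (fun k => FiberBundle.extend F (update b i u k)) =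
      update (fun k => FiberBundle.extend F (b k)) i (FiberBundle.extend F u) := by
  ext k
  by_cases h : k = i
  · subst h; simp
  · simp [h]

/-- The covariant derivative `∇_v η` of a form, as an alternating form on the fibre at `x`:
`(∇_v η)(b₁, …, bₚ) = v(η(B₁, …, Bₚ)) - ∑ⱼ η(b₁, …, ∇_v Bⱼ, …, bₚ)`, where the `Bⱼ` are any smooth
sections with `Bⱼ x = bⱼ`. -/
def covForm (cov : CovariantDerivative I F V) {p : ℕ} (η : EForm I F V p) (x : M) :
    TangentSpace I x →ₗ[ℝ] V x [⋀^Fin p]→ₗ[ℝ] ℝ where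
  toFun v :=
    { toFun := fun b => covFormAux cov η x v fun i => FiberBundle.extend F (b i)
      map_update_add' := by
        intro inst b i u w
        rw [Subsingleton.elim inst (instDecidableEqFin p)]
        have : ContMDiffVectorBundle 1 F V I := ContMDiffVectorBundle.of_le (n := ∞) (by simp)
        have T := covFormAux_tensorial cov η x v
          (B := fun k => FiberBundle.extend F (b k)) (fun k => FiberBundle.mdifferentiableAt_extend I F (b k)) i
        simp only [extend_update]
        exact map_add (TensorialAt.mkHom _ x T) u w
      map_update_smul' := by
        intro inst b i c u
        rw [Subsingleton.elim inst (instDecidableEqFin p)]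
        have : ContMDiffVectorBundle 1 F V I := ContMDiffVectorBundle.of_le (n := ∞) (by simp)
        have T := covFormAux_tensorial cov η x v
          (B := fun k => FiberBundle.extend F (b k)) (fun k => FiberBundle.mdifferentiableAt_extend I F (b k)) i
        simp only [extend_update]
        exact map_smul (TensorialAt.mkHom _ x T) c u
      map_eq_zero_of_eq' := by
        intro b i j hb hij
        have h0 : (fun y => η.1 y fun k => FiberBundle.extend F (b k) y) = fun _ => 0 := by
          ext y
          exact (η.1 y).map_eq_zero_of_eq _ (by simp [hb]) hij
        simp only [covFormAux, h0, mvfderiv_const, FiberBundle.extend_apply_self,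
          zero_apply, zero_sub, neg_eq_zero]
        rw [Fintype.sum_eq_add i j hij, hb]
        · have e : (update b j (cov (FiberBundle.extend F (b j)) x v)) =
              update b i (cov (FiberBundle.extend F (b j)) x v) ∘ Equiv.swap i j := by
            ext k
            by_cases h : k = i
            · subst h; simp [hij, hij.symm, hb]
            by_cases h' : k = j
            · subst h'; simp
            simp [h, h', Equiv.swap_apply_of_ne_of_ne]
          rw [e]
          exact (η.1 x).map_add_swap _ hij
        · rintro k ⟨hi, hj⟩
          exact (η.1 x).map_eq_zero_of_eq _ (by simp [hi.symm, hj.symm, hb]) hij }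
  map_add' v w := by
    ext b
    simp only [covFormAux, map_add, AlternatingMap.map_update_add, Finset.sum_add_distrib,
      AlternatingMap.add_apply, AlternatingMap.coe_mk, MultilinearMap.coe_mk]
    ring
  map_smul' c v := by
    ext b
    simp only [covFormAux, map_smul, AlternatingMap.map_update_smul, ← Finset.smul_sum,
      AlternatingMap.smul_apply, AlternatingMap.coe_mk, MultilinearMap.coe_mk, RingHom.id_apply,
      smul_sub]

theorem covForm_apply (cov : CovariantDerivative I F V) {p : ℕ} (η : EForm I F V p) (x : M)
    (v : TangentSpace I x) (B : Fin p → Cₛ^∞⟮I; F, V⟯) :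
    covForm cov η x v (fun i => B i x) = covFormAux cov η x v fun i => B i := by
  have : ContMDiffVectorBundle 1 F V I := ContMDiffVectorBundle.of_le (n := ∞) (by simp)
  have key : ∀ s : Finset (Fin p),
      covFormAux cov η x v (fun i => FiberBundle.extend F (B i x)) =
        covFormAux cov η x v fun i => if i ∈ s then B i else FiberBundle.extend F (B i x) := by
    intro s
    induction s using Finset.induction_on with
    | empty => simp
    | insert a s ha ih =>
      rw [ih]
      set C : Fin p → ∀ y, V y := fun i => if i ∈ s then B i else FiberBundle.extend F (B i x)
        with hC
      have hCd : ∀ i, MDifferentiableAt I (I.prod 𝓘(ℝ, F))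
          (fun y => (⟨y, C i y⟩ : TotalSpace F V)) x := by
        intro i
        by_cases h : i ∈ s
        · simpa [hC, h] using (B i).mdifferentiableAt
        · simpa [hC, h] using FiberBundle.mdifferentiableAt_extend I F (B i x)
      have T := (covFormAux_tensorial cov η x v hCd a).pointwise
        (FiberBundle.mdifferentiableAt_extend I F (B a x)) (B a).mdifferentiableAt (by simp)
      have e1 : update C a (FiberBundle.extend F (B a x)) = C := by
        rw [update_eq_self_iff]; simp [hC, ha]
      have e2 : update C a (B a) =
          fun i => if i ∈ insert a s then ⇑(B i) else FiberBundle.extend F (B i x) := by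
        ext i
        by_cases h : i = a
        · subst h; simp
        · simp [h, hC]
      rw [← e2, ← T, e1]
  have h := key Finset.univ
  simp only [Finset.mem_univ, if_true] at h
  exact h

/-- The operator `∇_q` on forms, for a bundle map `q : V → TM` and a linear connection `∇`:
`(∇_q η)(A₀, …, Aₚ) = ∑ᵢ (-1)ⁱ (∇_{qAᵢ} η)(A₀, …, Âᵢ, …, Aₚ)`. -/
def nablaForm (cov : CovariantDerivative I F V) [cov.ContMDiffCovariantDerivative ∞]
    (q : BundleMapToTangent I F V) {p : ℕ} (η : EForm I F V p) : EForm I F V (p + 1) :=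
  ⟨fun x => AlternatingMap.alternatizeUncurryFin (covForm cov η x ∘ₗ (q.toFun x).toLinearMap), by
    intro A
    have e : ∀ x, AlternatingMap.alternatizeUncurryFin
        (covForm cov η x ∘ₗ (q.toFun x).toLinearMap) (fun i => A i x) =
        ∑ i : Fin (p + 1), (-1 : ℝ) ^ (i : ℕ) *
          (anchorDeriv q (A i) (evalForm η (i.removeNth A)) x -
            ∑ j, evalForm η (update (i.removeNth A) j (covAlong cov q (A i) (i.removeNth A j))) x) := by
      intro x
      rw [AlternatingMap.alternatizeUncurryFin_apply]
      refine Finset.sum_congr rfl fun i _ => ?_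
      rw [zsmul_eq_mul]
      push_cast
      congr 1
      refine (covForm_apply cov η x (q.toFun x (A i x)) (i.removeNth A)).trans ?_
      rw [covFormAux]
      congr 1
      refine Finset.sum_congr rfl fun j _ => ?_
      refine congrArg (η.1 x) ?_
      ext k
      by_cases h : k = j
      · subst h; simp [covAlong]
      · simp [h]
    simp only [e]
    refine contMDiff_finsetSum fun i _ => contMDiff_const.mul ?_
    exact (contMDiff_anchorDeriv q (A i) _).sub
      (contMDiff_finsetSum fun j _ => (evalForm η _).contMDiff)⟩

/-- The insertion of an alternating bilinear map `L : W × W → W` into an alternating form. -/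
def insertAlt {W : Type*} [AddCommGroup W] [Module ℝ W] (L : W [⋀^Fin 2]→ₗ[ℝ] W) :
    ∀ {p : ℕ}, (W [⋀^Fin p]→ₗ[ℝ] ℝ) → W [⋀^Fin (p + 1)]→ₗ[ℝ] ℝ
  | 0, _ => 0
  | _ + 1, η => (1 / 2 : ℝ) • AlternatingMap.alternatizeUncurryFin
      (AlternatingMap.alternatizeUncurryFinLM ∘ₗ LinearMap.mk₂ ℝ
        (fun a b => η.curryLeft (L ![a, b]))
        (fun a a' b => by rw [← map_add]; congr 1; exact L.map_vecCons_add _ _ _)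
        (fun c a b => by rw [← map_smul]; congr 1; exact L.map_vecCons_smul _ _ _)
        (fun a b b' => by
          rw [← map_add]; congr 1
          exact (L.curryLeft a).map_vecCons_add ![] b b')
        (fun c a b => by
          rw [← map_smul]; congr 1
          exact (L.curryLeft a).map_vecCons_smul ![] c b))

/-- The usual formula for the insertion, as a sum over the pairs `i < j + 1`, that is over the
`(2, p)`-shuffles:
`∑ (-1)^(i+j) η(L(vᵢ, v_{j+1}), v₀, …, v̂ᵢ, …, v̂_{j+1}, …, v_{p+1})`. -/
theorem insertAlt_apply {W : Type*} [AddCommGroup W] [Module ℝ W] (L : W [⋀^Fin 2]→ₗ[ℝ] W)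
    {p : ℕ} (η : W [⋀^Fin (p + 1)]→ₗ[ℝ] ℝ) (v : Fin (p + 2) → W) :
    insertAlt L η v = ∑ i : Fin (p + 1), ∑ j ≥ i, (-1 : ℝ) ^ (i + j : ℕ) *
      η (Matrix.vecCons (L ![v i.castSucc, v j.succ]) (j.removeNth (i.castSucc.removeNth v))) := by
  have hL : ∀ a b : W, L ![b, a] = - L ![a, b] := by
    intro a b
    have := L.map_swap ![a, b] (i := 0) (j := 1) (by simp)
    rw [← this]
    congr 1
    ext k; fin_cases k <;> simp
  simp only [insertAlt, AlternatingMap.smul_apply,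
    AlternatingMap.alternatizeUncurryFin_alternatizeUncurryFinLM_comp_apply, LinearMap.mk₂_apply,
    Finset.smul_sum]
  refine Finset.sum_congr rfl fun i _ => Finset.sum_congr rfl fun j _ => ?_
  rw [hL (v i.castSucc) (v j.succ), map_neg]
  simp only [AlternatingMap.neg_apply, AlternatingMap.curryLeft_apply_apply, sub_neg_eq_add,
    zsmul_eq_mul, smul_eq_mul]
  push_cast
  ring

/-- The insertion operator `ι_L` of a form `L ∈ Γ(Λ² V* ⊗ V)`. -/
def insertion (L : EValuedForm I F V 2) : ∀ {p : ℕ}, EForm I F V p → EForm I F V (p + 1)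
  | 0, η => ⟨fun x => insertAlt (L.toFun x) (η.1 x), fun _ => contMDiff_const⟩
  | p + 1, η => ⟨fun x => insertAlt (L.toFun x) (η.1 x), fun A => by
      simp only [insertAlt_apply]
      refine contMDiff_finsetSum fun i _ => contMDiff_finsetSum fun j _ => contMDiff_const.mul ?_
      convert (evalForm η (Matrix.vecCons (EValuedForm.eval L ![A i.castSucc, A j.succ])
        (j.removeNth (i.castSucc.removeNth A)))).contMDiff using 2 with x
      refine congrArg (η.1 x) ?_
      ext k
      refine Fin.cases ?_ (fun k => ?_) k
      · refine congrArg (L.toFun x) ?_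
        ext l; fin_cases l <;> rfl
      · rfl⟩

end LieAlgd

end

noncomputable section

set_option linter.unusedSectionVars false

namespace LieAlgd

/-! ### Alternating forms as functions on lists -/

section ListForms

variable {W : Type*}

/-! The operator `∇_q + ι_L`, with `L` the torsion of `δ_A B = ∇_{qA} B`, is itself shown to be a
derivation of degree 1 that agrees with the differential of the Lie algebroid in degrees 0 and 1.
This proves existence of `D`. A derivation is determined by its values on functions and 1-forms, so
it also proves uniqueness and the formula for `D`.

The torsion is a tensor because the derivatives of `f` produced by the connection and by the bracket
cancel (`EConnection.torsionLM_fmul_right`). In degree 1, `∇_q α` differs from `Dα` exactly by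
`-α(L(A, B))`, which the insertion restores (`isDifferential_nablaAddInsertion`).

The Leibniz rules are sign computations, and shuffles suit them badly. A form on a vector space is
therefore encoded as a function on lists (`altList`): contraction becomes prepending an element, the
exterior product becomes the recursion `listWedge` (`altList_wedgeAlt`), and both operators become
instances of one alternating sum `listAlt`. Everything then rests on two identities proved by
induction on lists, `listAlt_wedge_left` and `listAlt_wedge_right`, together with the fact that
`∇_v` is a derivation of degree 0 (`covForm_wedge`).

Uniqueness uses no separate locality argument. Cutting off a local frame gives global `e_k`, `θ_k`
and a function `ρ` with `ρ x = 1` and `∑ θ_k ∧ i_{e_k} η = (deg η) ρ η` (`sum_wedge_contract`).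
Applying `D` to this identity of global forms determines `Dη` at `x` by induction on the degree
(`DerivationOne.ext_of_deg_le_one`). -/

/-- The product of functions on lists given by the contraction rule
`i_x (φ ∧ ψ) = i_x φ ∧ ψ + (-1)^deg φ ∧ i_x ψ`. -/
def listWedge : (List W → ℝ) → (List W → ℝ) → List W → ℝ
  | φ, ψ, [] => φ [] * ψ []
  | φ, ψ, x :: l => listWedge (fun m => φ (x :: m)) ψ l +
      listWedge (fun m => (-1) ^ m.length * φ m) (fun m => ψ (x :: m)) l

/-- The alternating sum `∑ᵢ (-1)ⁱ a(xᵢ)(x₀, …, x̂ᵢ, …)`. -/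
def listAlt : (W → List W → ℝ) → List W → ℝ
  | _, [] => 0
  | a, x :: l => a x l - listAlt (fun y m => a y (x :: m)) l

theorem listWedge_add_left (l : List W) : ∀ φ φ' ψ : List W → ℝ,
    listWedge (φ + φ') ψ l = listWedge φ ψ l + listWedge φ' ψ l := by
  induction l with
  | nil => intros; simp [listWedge, add_mul]
  | cons x l ih =>
    intro φ φ' ψ
    have h1 := ih (fun m => φ (x :: m)) (fun m => φ' (x :: m)) ψ
    have h2 := ih (fun m => (-1) ^ m.length * φ m) (fun m => (-1) ^ m.length * φ' m)
      (fun m => ψ (x :: m))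
    have e : (fun m : List W => (-1) ^ m.length * (φ + φ') m) =
        (fun m => (-1) ^ m.length * φ m) + fun m => (-1) ^ m.length * φ' m := by
      ext m; simp [mul_add]
    simp only [listWedge, e, h2]
    rw [show (fun m : List W => (φ + φ') (x :: m)) =
      (fun m => φ (x :: m)) + fun m => φ' (x :: m) from rfl, h1]
    ring

theorem listWedge_add_right (l : List W) : ∀ φ ψ ψ' : List W → ℝ,
    listWedge φ (ψ + ψ') l = listWedge φ ψ l + listWedge φ ψ' l := by
  induction l with
  | nil => intros; simp [listWedge, mul_add]
  | cons x l ih =>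
    intro φ ψ ψ'
    simp only [listWedge, ih]
    rw [show (fun m : List W => (ψ + ψ') (x :: m)) =
      (fun m => ψ (x :: m)) + fun m => ψ' (x :: m) from rfl, ih]
    ring

theorem listWedge_smul_left (c : ℝ) (l : List W) : ∀ φ ψ : List W → ℝ,
    listWedge (c • φ) ψ l = c * listWedge φ ψ l := by
  induction l with
  | nil => intros; simp [listWedge, mul_assoc]
  | cons x l ih =>
    intro φ ψ
    have e : (fun m : List W => (-1) ^ m.length * (c • φ) m) =
        c • fun m => (-1) ^ m.length * φ m := by
      ext m; simp [mul_left_comm]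
    simp only [listWedge, e, ih]
    rw [show (fun m : List W => (c • φ) (x :: m)) = c • fun m => φ (x :: m) from rfl, ih]
    ring

theorem listWedge_smul_right (c : ℝ) (l : List W) : ∀ φ ψ : List W → ℝ,
    listWedge φ (c • ψ) l = c * listWedge φ ψ l := by
  induction l with
  | nil => intros; simp [listWedge, mul_left_comm]
  | cons x l ih =>
    intro φ ψ
    simp only [listWedge, ih]
    rw [show (fun m : List W => (c • ψ) (x :: m)) = c • fun m => ψ (x :: m) from rfl, ih]
    ring

theorem listWedge_zero_left (ψ : List W → ℝ) (l : List W) : listWedge 0 ψ l = 0 := by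
  simpa using listWedge_smul_left 0 l 0 ψ

theorem listWedge_zero_right (φ : List W → ℝ) (l : List W) : listWedge φ 0 l = 0 := by
  simpa using listWedge_smul_right 0 l φ 0

theorem listAlt_add (l : List W) : ∀ a b : W → List W → ℝ,
    listAlt (a + b) l = listAlt a l + listAlt b l := by
  induction l with
  | nil => intros; simp [listAlt]
  | cons x l ih =>
    intro a b
    have := ih (fun y m => a y (x :: m)) (fun y m => b y (x :: m))
    simp only [listAlt]
    rw [show (fun y (m : List W) => (a + b) y (x :: m)) =
      (fun y m => a y (x :: m)) + fun y m => b y (x :: m) from rfl, this]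
    simp only [Pi.add_apply]
    ring

theorem listAlt_smul (c : ℝ) (l : List W) : ∀ a : W → List W → ℝ,
    listAlt (c • a) l = c * listAlt a l := by
  induction l with
  | nil => intros; simp [listAlt]
  | cons x l ih =>
    intro a
    have := ih (fun y m => a y (x :: m))
    simp only [listAlt]
    rw [show (fun y (m : List W) => (c • a) y (x :: m)) = c • fun y m => a y (x :: m) from rfl,
      this]
    simp only [Pi.smul_apply, smul_eq_mul]
    ring

theorem neg_one_pow_length_twice (φ : List W → ℝ) :
    (fun m : List W => (-1 : ℝ) ^ m.length * ((-1) ^ m.length * φ m)) = φ := by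
  ext m
  rw [← mul_assoc, ← mul_pow]; simp

/-- No sign appears because the new argument `y` enters in front of `a y`, hence in front of the
whole product. The induction must generalise both factors, since the recursion of `listWedge` twists
the left one and contracts the right one. -/
theorem listAlt_wedge_left (l : List W) : ∀ (a : W → List W → ℝ) (ψ : List W → ℝ),
    listAlt (fun y => listWedge (a y) ψ) l = listWedge (listAlt a) ψ l := by
  induction l with
  | nil => intros; simp [listAlt, listWedge]
  | cons x l ih =>
    intro a ψ
    have h1 := ih (fun y m => a y (x :: m)) ψ
    have h2 := ih (fun y m => (-1) ^ m.length * a y m) (fun m => ψ (x :: m))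
    have e1 : (fun m => listAlt a (x :: m)) =
        a x + (-1 : ℝ) • listAlt (fun y m => a y (x :: m)) := by
      ext m; simp [listAlt, sub_eq_add_neg]
    -- `listAlt` evaluates `b` on lists one shorter than `m`, so the parity twist anticommutes with
    -- it. This minus sign cancels the one in the recursion of `listAlt`.
    have e2 : ∀ (m : List W) (b : W → List W → ℝ),
        listAlt (fun y m => (-1) ^ m.length * b y m) m = (-1) * ((-1) ^ m.length * listAlt b m) := by
      intro m
      induction m with
      | nil => simp [listAlt]
      | cons z m ih =>
        intro b
        have h := ih ((-1 : ℝ) • fun y m => b y (z :: m))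
        rw [listAlt_smul] at h
        have h3 : (fun y (m : List W) => (-1 : ℝ) ^ (z :: m).length * b y (z :: m)) =
            fun y m => (-1) ^ m.length * ((-1 : ℝ) • fun y m => b y (z :: m)) y m := by
          ext y m; simp [pow_succ]
        simp only [listAlt]
        rw [h3, h, List.length_cons, pow_succ]
        ring
    have e2' : listAlt (fun y m => (-1) ^ m.length * a y m) =
        (-1 : ℝ) • fun m => (-1) ^ m.length * listAlt a m := by
      ext m; simpa using e2 m a
    simp only [listWedge, e1, listWedge_add_left, listWedge_smul_left, ← h1]
    rw [e2', listWedge_smul_left] at h2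
    rw [listAlt]
    have h3 := listAlt_add l (fun y => listWedge (fun m => a y (x :: m)) ψ)
      (fun y => listWedge (fun m => (-1) ^ m.length * a y m) (fun m => ψ (x :: m)))
    rw [show (fun y (m : List W) => listWedge (a y) ψ (x :: m)) =
      (fun y => listWedge (fun m => a y (x :: m)) ψ) +
      (fun y => listWedge (fun m => (-1) ^ m.length * a y m) (fun m => ψ (x :: m))) from rfl, h3, h2]
    ring

/-- Here the new argument has to pass all the arguments of `φ`, which costs the degree of `φ`. The
length of the list stands in for that degree, so `φ` need not be homogeneous. -/
theorem listAlt_wedge_right (l : List W) : ∀ (φ : List W → ℝ) (b : W → List W → ℝ),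
    listAlt (fun y => listWedge φ (b y)) l =
      listWedge (fun m => (-1) ^ m.length * φ m) (listAlt b) l := by
  induction l with
  | nil => intros; simp [listAlt, listWedge]
  | cons x l ih =>
    intro φ b
    have h1 := ih (fun m => φ (x :: m)) b
    have h2 := ih (fun m => (-1) ^ m.length * φ m) (fun y m => b y (x :: m))
    rw [neg_one_pow_length_twice] at h2
    have e1 : (fun m => listAlt b (x :: m)) =
        b x + (-1 : ℝ) • listAlt (fun y m => b y (x :: m)) := by
      ext m; simp [listAlt, sub_eq_add_neg]
    have e3 : (fun m : List W => (-1 : ℝ) ^ (x :: m).length * φ (x :: m)) =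
        (-1 : ℝ) • fun m => (-1) ^ m.length * φ (x :: m) := by
      ext m; simp [pow_succ]
    simp only [listWedge, e1, e3, listWedge_add_right, listWedge_smul_right, listWedge_smul_left,
      neg_one_pow_length_twice, ← h1, ← h2]
    rw [listAlt]
    have h3 := listAlt_add l (fun y => listWedge (fun m => φ (x :: m)) (b y))
      (fun y => listWedge (fun m => (-1) ^ m.length * φ m) (fun m => b y (x :: m)))
    rw [show (fun y (m : List W) => listWedge φ (b y) (x :: m)) =
      (fun y => listWedge (fun m => φ (x :: m)) (b y)) +
      (fun y => listWedge (fun m => (-1) ^ m.length * φ m) (fun m => b y (x :: m))) from rfl, h3]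
    ring

end ListForms

/-! ### Alternating forms on a vector space encoded on lists -/

section AltList

variable {W : Type*} [AddCommGroup W] [Module ℝ W]

/-- An alternating `p`-form as a function on lists, zero on the lists of length other than `p`. -/
def altList {p : ℕ} (η : W [⋀^Fin p]→ₗ[ℝ] ℝ) (l : List W) : ℝ :=
  if l.length = p then η fun i => l.getD i 0 else 0

theorem altList_ofFn {p : ℕ} (η : W [⋀^Fin p]→ₗ[ℝ] ℝ) (v : Fin p → W) :
    altList η (List.ofFn v) = η v := by
  simp [altList]

theorem altList_injective {p : ℕ} : Injective (altList (W := W) (p := p)) := by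
  intro η η' h
  ext v
  rw [← altList_ofFn, h, altList_ofFn]

theorem altList_add {p : ℕ} (η η' : W [⋀^Fin p]→ₗ[ℝ] ℝ) :
    altList (η + η') = altList η + altList η' := by
  ext l; by_cases h : l.length = p <;> simp [altList, h]

theorem altList_smul {p : ℕ} (c : ℝ) (η : W [⋀^Fin p]→ₗ[ℝ] ℝ) :
    altList (c • η) = c • altList η := by
  ext l; by_cases h : l.length = p <;> simp [altList, h]

theorem altList_neg {p : ℕ} (η : W [⋀^Fin p]→ₗ[ℝ] ℝ) : altList (-η) = -altList η := by
  ext l; by_cases h : l.length = p <;> simp [altList, h]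

theorem altList_zero {p : ℕ} : altList (0 : W [⋀^Fin p]→ₗ[ℝ] ℝ) = 0 := by
  ext l; simp [altList]

theorem altList_domDomCongr {p k : ℕ} (h : p = k) (η : W [⋀^Fin p]→ₗ[ℝ] ℝ) :
    altList (η.domDomCongr (finCongr h)) = altList η := by
  subst h; rfl

theorem altList_deg_zero_cons (η : W [⋀^Fin 0]→ₗ[ℝ] ℝ) (x : W) (m : List W) :
    altList η (x :: m) = 0 := by
  simp [altList]

/-- Contraction is prepending. The convention that the value is zero in the wrong length makes this
hold for every list. -/
theorem altList_succ_cons {p : ℕ} (η : W [⋀^Fin (p + 1)]→ₗ[ℝ] ℝ) (x : W) (m : List W) :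
    altList η (x :: m) = altList (η.curryLeft x) m := by
  simp only [altList, List.length_cons, Nat.add_right_cancel_iff]
  split_ifs with h
  · rw [AlternatingMap.curryLeft_apply_apply]
    congr 1
    ext i
    refine Fin.cases ?_ (fun i => ?_) i <;> simp
  · rfl

/-- A form of degree `p` lives on lists of length `p` only, so the parity of the length is the
parity of the degree. -/
theorem neg_one_pow_length_altList {p : ℕ} (η : W [⋀^Fin p]→ₗ[ℝ] ℝ) :
    (fun m => (-1) ^ m.length * altList η m) = (-1 : ℝ) ^ p • altList η := by
  ext m
  by_cases h : m.length = p <;> simp [altList, h]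

/-- This is the recursion of `listAlt` for forms: the term `i = 0` uses up `x`, and in the others
`x` stays as first argument while the index shift reverses the sign. -/
theorem curryLeft_alternatizeUncurryFin {p : ℕ} (a : W →ₗ[ℝ] W [⋀^Fin (p + 1)]→ₗ[ℝ] ℝ) (x : W) :
    (AlternatingMap.alternatizeUncurryFin a).curryLeft x = a x -
      AlternatingMap.alternatizeUncurryFin
        ((LinearMap.applyₗ x ∘ₗ AlternatingMap.curryLeftLinearMap) ∘ₗ a) := by
  ext v
  rw [AlternatingMap.curryLeft_apply_apply, AlternatingMap.alternatizeUncurryFin_apply,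
    Fin.sum_univ_succ, AlternatingMap.sub_apply, AlternatingMap.alternatizeUncurryFin_apply,
    sub_eq_add_neg, ← Finset.sum_neg_distrib]
  congr 1
  · simp [Matrix.vecCons]
  · refine Finset.sum_congr rfl fun i _ => ?_
    simp [pow_succ, Matrix.vecCons]
    congr 2
    ext j
    refine Fin.cases ?_ (fun j => ?_) j <;> simp [Fin.removeNth]

theorem altList_alternatizeUncurryFin (l : List W) : ∀ {p : ℕ} (a : W →ₗ[ℝ] W [⋀^Fin p]→ₗ[ℝ] ℝ),
    altList (AlternatingMap.alternatizeUncurryFin a) l = listAlt (fun y => altList (a y)) l := by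
  induction l with
  | nil => intros; simp [altList, listAlt]
  | cons x l ih =>
    intro p a
    rw [altList_succ_cons, listAlt]
    cases p with
    | zero =>
      simp only [altList_deg_zero_cons]
      have h0 := listAlt_smul 0 l (fun (_ : W) (_ : List W) => (0 : ℝ))
      simp only [zero_smul, zero_mul] at h0
      have h0' : listAlt (fun (_ : W) (_ : List W) => (0 : ℝ)) l = 0 := h0
      rw [h0', sub_zero]
      congr 1
      ext v
      rw [AlternatingMap.curryLeft_apply_apply, AlternatingMap.alternatizeUncurryFin_apply]
      simp
    | succ p =>
      rw [curryLeft_alternatizeUncurryFin, sub_eq_add_neg, altList_add, altList_neg]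
      simp only [altList_succ_cons, Pi.add_apply, Pi.neg_apply, ih]
      rfl

/-- The alternating sum of a function over the permutations of its arguments. -/
def altSum {n : ℕ} (g : (Fin n → W) → ℝ) (v : Fin n → W) : ℝ :=
  ∑ σ : Equiv.Perm (Fin n), (Equiv.Perm.sign σ : ℤ) * g (v ∘ σ)

/-- Permutations of `n + 1` letters are grouped by the position `i` at which `x` ends up. Bringing
`x` from there to the front is the cycle `cycleRange i`, of sign `(-1)^i`, and the rest is a
permutation of the other `n` letters. -/
theorem altSum_cons {n : ℕ} (g : (Fin (n + 1) → W) → ℝ) (x : W) (v : Fin n → W) :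
    altSum g (Matrix.vecCons x v) =
      ∑ i : Fin (n + 1), (-1) ^ (i : ℕ) * altSum (fun w => g (i.insertNth x w)) v := by
  simp only [altSum, Finset.mul_sum]
  rw [← Fintype.sum_prod_type' (f := fun (i : Fin (n + 1)) (ρ : Equiv.Perm (Fin n)) =>
    (-1 : ℝ) ^ (i : ℕ) * ((Equiv.Perm.sign ρ : ℤ) * g (i.insertNth x (v ∘ ρ))))]
  symm
  let e : Fin (n + 1) × Equiv.Perm (Fin n) → Equiv.Perm (Fin (n + 1)) := fun z =>
    Equiv.Perm.decomposeFin.symm (0, z.2) * z.1.cycleRange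
  have he : Injective e := by
    rintro ⟨i, ρ⟩ ⟨j, τ⟩ h
    have h1 : ∀ (i : Fin (n + 1)) (ρ : Equiv.Perm (Fin n)), e (i, ρ) i = 0 := by
      intro i ρ; simp [e]
    have hij : i = j := by
      have := h1 i ρ
      rw [h, ← h1 j τ] at this
      exact (e (j, τ)).injective this
    subst hij
    have h2 := mul_right_cancel h
    simpa using h2
  -- Surjectivity follows by counting: `(n + 1) * n! = (n + 1)!`.
  have hb : Bijective e := (Fintype.bijective_iff_injective_and_card e).2
    ⟨he, by simp [Fintype.card_perm, Nat.factorial_succ]⟩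
  refine Fintype.sum_bijective e hb _ _ fun z => ?_
  have hv : Matrix.vecCons x v ∘ e z = z.1.insertNth x (v ∘ z.2) := by
    rw [← Fin.cons_comp_cycleRange]
    ext k
    simp only [e, comp_apply, Equiv.Perm.coe_mul]
    refine Fin.cases ?_ (fun k => ?_) (z.1.cycleRange k) <;> simp
  rw [hv]
  simp only [e, Equiv.Perm.sign_mul, Equiv.Perm.decomposeFin.symm_sign, Fin.sign_cycleRange]
  push_cast
  simp
  ring

end AltList

/-! ### The exterior product and the insertion on lists -/

section WedgeList

variable {W : Type*} [AddCommGroup W] [Module ℝ W]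

/-- The product of the values of `α` on the first and of `β` on the last arguments. -/
def splitMul {n p k : ℕ} (h : p + k = n) (α : W [⋀^Fin p]→ₗ[ℝ] ℝ) (β : W [⋀^Fin k]→ₗ[ℝ] ℝ)
    (w : Fin n → W) : ℝ :=
  α (fun i => w (Fin.cast h (Fin.castAdd k i))) * β (fun j => w (Fin.cast h (Fin.natAdd p j)))

/-- An `x` inserted in the first block is moved to the front of that block by alternation, and the
second block only has its indices shifted. -/
theorem splitMul_insertNth_left {n p k : ℕ} (h : p + 1 + k = n + 1) (h' : p + k = n)
    (α : W [⋀^Fin (p + 1)]→ₗ[ℝ] ℝ) (β : W [⋀^Fin k]→ₗ[ℝ] ℝ) (s : Fin (p + 1)) (x : W)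
    (w : Fin n → W) :
    splitMul h α β (Fin.insertNth (Fin.cast h (Fin.castAdd k s)) x w) =
      (-1) ^ (s : ℕ) * splitMul h' (α.curryLeft x) β w := by
  have e1 : (fun i => (Fin.insertNth (Fin.cast h (Fin.castAdd k s)) x w : Fin (n + 1) → W)
      (Fin.cast h (Fin.castAdd k i))) =
      s.insertNth x fun i => w (Fin.cast h' (Fin.castAdd k i)) := by
    rw [Fin.eq_insertNth_iff]
    refine ⟨Fin.insertNth_apply_same _ _ _, ?_⟩
    ext i
    have : Fin.cast h (Fin.castAdd k (s.succAbove i)) =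
        (Fin.cast h (Fin.castAdd k s)).succAbove (Fin.cast h' (Fin.castAdd k i)) := by
      ext; simp only [Fin.succAbove, Fin.lt_def]; split_ifs <;> simp_all <;> omega
    simp only [Fin.removeNth]
    rw [this, Fin.insertNth_apply_succAbove]
  have e2 : ∀ j, (Fin.insertNth (Fin.cast h (Fin.castAdd k s)) x w : Fin (n + 1) → W)
      (Fin.cast h (Fin.natAdd (p + 1) j)) = w (Fin.cast h' (Fin.natAdd p j)) := by
    intro j
    have : Fin.cast h (Fin.natAdd (p + 1) j) =
        (Fin.cast h (Fin.castAdd k s)).succAbove (Fin.cast h' (Fin.natAdd p j)) := by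
      ext; simp only [Fin.succAbove, Fin.lt_def]; split_ifs <;> simp_all <;> omega
    rw [this, Fin.insertNth_apply_succAbove]
  simp only [splitMul, e1, e2, AlternatingMap.map_insertNth, AlternatingMap.curryLeft_apply_apply,
    zsmul_eq_mul]
  push_cast
  ring

/-- The sign counts the position `t` inside the second block, not the position `p + t` in the whole
list. -/
theorem splitMul_insertNth_right {n p k : ℕ} (h : p + (k + 1) = n + 1) (h' : p + k = n)
    (α : W [⋀^Fin p]→ₗ[ℝ] ℝ) (β : W [⋀^Fin (k + 1)]→ₗ[ℝ] ℝ) (t : Fin (k + 1)) (x : W)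
    (w : Fin n → W) :
    splitMul h α β (Fin.insertNth (Fin.cast h (Fin.natAdd p t)) x w) =
      (-1) ^ (t : ℕ) * splitMul h' α (β.curryLeft x) w := by
  have e1 : (fun j => (Fin.insertNth (Fin.cast h (Fin.natAdd p t)) x w : Fin (n + 1) → W)
      (Fin.cast h (Fin.natAdd p j))) =
      t.insertNth x fun j => w (Fin.cast h' (Fin.natAdd p j)) := by
    rw [Fin.eq_insertNth_iff]
    refine ⟨Fin.insertNth_apply_same _ _ _, ?_⟩
    ext i
    have : Fin.cast h (Fin.natAdd p (t.succAbove i)) =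
        (Fin.cast h (Fin.natAdd p t)).succAbove (Fin.cast h' (Fin.natAdd p i)) := by
      ext; simp only [Fin.succAbove, Fin.lt_def]; split_ifs <;> simp_all <;> omega
    simp only [Fin.removeNth]
    rw [this, Fin.insertNth_apply_succAbove]
  have e2 : ∀ j, (Fin.insertNth (Fin.cast h (Fin.natAdd p t)) x w : Fin (n + 1) → W)
      (Fin.cast h (Fin.castAdd (k + 1) j)) = w (Fin.cast h' (Fin.castAdd k j)) := by
    intro j
    have : Fin.cast h (Fin.castAdd (k + 1) j) =
        (Fin.cast h (Fin.natAdd p t)).succAbove (Fin.cast h' (Fin.castAdd k j)) := by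
      ext; simp only [Fin.succAbove, Fin.lt_def]; split_ifs <;> simp_all <;> omega
    rw [this, Fin.insertNth_apply_succAbove]
  simp only [splitMul, e1, e2, AlternatingMap.map_insertNth, AlternatingMap.curryLeft_apply_apply,
    zsmul_eq_mul]
  push_cast
  ring

theorem altSum_const_mul {n : ℕ} (c : ℝ) (g : (Fin n → W) → ℝ) (v : Fin n → W) :
    altSum (fun w => c * g w) v = c * altSum g v := by
  simp only [altSum, Finset.mul_sum]
  exact Finset.sum_congr rfl fun _ _ => by ring

/-- Expanding along the first argument reproduces the contraction rule. Each of the `p` positions in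
the first block contributes the same term, and so does each of the `k` positions in the second
block. The factors `p` and `k` complete the factorials. -/
theorem altSum_splitMul (n : ℕ) : ∀ {p k : ℕ} (h : p + k = n) (α : W [⋀^Fin p]→ₗ[ℝ] ℝ)
    (β : W [⋀^Fin k]→ₗ[ℝ] ℝ) (v : Fin n → W),
    altSum (splitMul h α β) v =
      p.factorial * k.factorial * listWedge (altList α) (altList β) (List.ofFn v) := by
  induction n with
  | zero =>
    intro p k h α β v
    obtain rfl : p = 0 := by omega
    obtain rfl : k = 0 := by omega
    simp [altSum, splitMul, listWedge, altList]
    congr 2 <;> exact Subsingleton.elim _ _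
  | succ n ih =>
    intro p k h α β v
    obtain ⟨x, v, rfl⟩ : ∃ x w, v = Matrix.vecCons x w := ⟨v 0, fun i => v i.succ, by
      ext i; refine Fin.cases ?_ (fun i => ?_) i <;> simp⟩
    have hs : ∀ f : Fin (n + 1) → ℝ, ∑ i, f i = (∑ s : Fin p, f (Fin.cast h (Fin.castAdd k s))) +
        ∑ t : Fin k, f (Fin.cast h (Fin.natAdd p t)) := by
      intro f
      rw [← Fin.sum_univ_add (f := fun i => f (Fin.cast h i))]
      exact (Equiv.sum_comp (finCongr h) f).symm
    rw [altSum_cons, hs]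
    have hl : List.ofFn (Matrix.vecCons x v) = x :: List.ofFn v := by
      simp [List.ofFn_succ]
    rw [hl, listWedge, neg_one_pow_length_altList, listWedge_smul_left, mul_add]
    congr 1
    · cases p with
      | zero =>
        have : (fun m => altList α (x :: m)) = 0 := by ext m; simp [altList]
        rw [this, listWedge_zero_left]; simp
      | succ p =>
        have h' : p + k = n := by omega
        simp only [splitMul_insertNth_left h h', altSum_const_mul, ih h', altList_succ_cons,
          ← mul_assoc]
        simp [← mul_pow, Nat.factorial_succ]
        ring
    · cases k with
      | zero =>
        have : (fun m => altList β (x :: m)) = 0 := by ext m; simp [altList]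
        rw [this, listWedge_zero_right]; simp
      | succ k =>
        have h' : p + k = n := by omega
        simp only [splitMul_insertNth_right h h', altSum_const_mul, ih h', altList_succ_cons,
          ← mul_assoc]
        -- The position sign `(-1)^(p+t)` and the block sign `(-1)^t` leave `(-1)^p`, the sign of
        -- passing `α`.
        have hsq : ∀ t : Fin (k + 1), (-1 : ℝ) ^ (p + (t : ℕ)) * (-1) ^ (t : ℕ) = (-1) ^ p := by
          intro t
          rw [pow_add, mul_assoc, ← mul_pow]; simp
        simp only [Fin.val_cast, Fin.val_natAdd, hsq, Finset.sum_const, Finset.card_univ,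
          Fintype.card_fin, nsmul_eq_mul, Nat.factorial_succ]
        push_cast
        ring

/-- Summing over all permutations instead of shuffles counts each shuffle `p! k!` times. The full
sum does not involve representatives of cosets, which makes it accessible to induction. -/
theorem wedgeAlt_eq_altSum {p k : ℕ} (α : W [⋀^Fin p]→ₗ[ℝ] ℝ) (β : W [⋀^Fin k]→ₗ[ℝ] ℝ)
    (v : Fin (p + k) → W) :
    p.factorial * k.factorial * wedgeAlt α β v = altSum (splitMul rfl α β) v := by
  have h := congrArg (fun η => LinearMap.mul' ℝ ℝ (η (v ∘ finSumFinEquiv)))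
    (MultilinearMap.domCoprod_alternization_eq α β)
  simp only [AlternatingMap.smul_apply, map_nsmul, Fintype.card_fin] at h
  rw [nsmul_eq_mul] at h
  push_cast at h
  have h1 : wedgeAlt α β v = LinearMap.mul' ℝ ℝ (α.domCoprod β (v ∘ finSumFinEquiv)) := rfl
  rw [h1, ← h, MultilinearMap.alternatization_apply, map_sum]
  refine Fintype.sum_equiv (Equiv.permCongr finSumFinEquiv) _ _ fun σ => ?_
  rw [Units.smul_def, map_zsmul, zsmul_eq_mul, Equiv.Perm.sign_permCongr]
  congr 1
  simp [splitMul, MultilinearMap.domCoprod_apply, comp_def, Equiv.permCongr_apply]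

theorem listWedge_altList_eq_zero (l : List W) : ∀ {p k : ℕ} (α : W [⋀^Fin p]→ₗ[ℝ] ℝ)
    (β : W [⋀^Fin k]→ₗ[ℝ] ℝ), l.length ≠ p + k → listWedge (altList α) (altList β) l = 0 := by
  induction l with
  | nil =>
    intro p k α β h
    simp only [List.length_nil, ne_eq] at h
    by_cases hp : 0 = p
    · have hk : ¬ 0 = k := by omega
      simp [listWedge, altList, hk]
    · simp [listWedge, altList, hp]
  | cons x l ih =>
    intro p k α β h
    rw [List.length_cons] at h
    rw [listWedge, neg_one_pow_length_altList, listWedge_smul_left]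
    have h1 : listWedge (fun m => altList α (x :: m)) (altList β) l = 0 := by
      cases p with
      | zero =>
        have : (fun m => altList α (x :: m)) = 0 := by ext m; simp [altList]
        rw [this, listWedge_zero_left]
      | succ p =>
        simp only [altList_succ_cons]
        exact ih _ _ (by omega)
    have h2 : listWedge (altList α) (fun m => altList β (x :: m)) l = 0 := by
      cases k with
      | zero =>
        have : (fun m => altList β (x :: m)) = 0 := by ext m; simp [altList]
        rw [this, listWedge_zero_right]
      | succ k =>
        simp only [altList_succ_cons]
        exact ih _ _ (by omega)
    rw [h1, h2]; simp

theorem altList_wedgeAlt {p k : ℕ} (α : W [⋀^Fin p]→ₗ[ℝ] ℝ) (β : W [⋀^Fin k]→ₗ[ℝ] ℝ) :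
    altList (wedgeAlt α β) = listWedge (altList α) (altList β) := by
  ext l
  by_cases hl : l.length = p + k
  · obtain ⟨v, rfl⟩ : ∃ v : Fin (p + k) → W, l = List.ofFn v := by
      refine ⟨fun i => l.get (i.cast hl.symm), ?_⟩
      apply List.ext_get <;> simp [hl]
    have h := wedgeAlt_eq_altSum α β v
    rw [altSum_splitMul] at h
    rw [altList_ofFn]
    exact mul_left_cancel₀ (by positivity) h
  · rw [listWedge_altList_eq_zero l α β hl, altList, if_neg hl]

/-- The double alternating sum meets every unordered pair of arguments twice, whence the factor `1 /
2`. In degree 0 both sides vanish, because a 0-form is zero on nonempty lists. -/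
theorem altList_insertAlt (L : W [⋀^Fin 2]→ₗ[ℝ] W) {p : ℕ} (η : W [⋀^Fin p]→ₗ[ℝ] ℝ) :
    altList (insertAlt L η) = (1 / 2 : ℝ) • listAlt fun a => listAlt fun b m =>
      altList η (L ![a, b] :: m) := by
  cases p with
  | zero =>
    have h0 : ∀ l : List W, listAlt (fun _ _ => (0 : ℝ)) l = 0 := fun l => by
      have := listAlt_smul 0 l (0 : W → List W → ℝ)
      rw [zero_smul, zero_mul] at this
      exact this
    ext l
    simp only [insertAlt, altList_zero, altList_deg_zero_cons, Pi.smul_apply, Pi.zero_apply]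
    rw [show (fun _ : W => listAlt fun (_ : W) (_ : List W) => (0 : ℝ)) = fun _ _ => 0 by
      ext _ l; exact h0 l, h0]
    simp
  | succ p =>
    ext l
    simp only [insertAlt, altList_smul, Pi.smul_apply, altList_alternatizeUncurryFin]
    congr 2
    ext a m
    simp only [LinearMap.comp_apply, AlternatingMap.alternatizeUncurryFinLM_apply,
      altList_alternatizeUncurryFin]
    congr 1
    ext b m
    rw [altList_succ_cons]
    rfl

end WedgeList

section Uniqueness

variable {E : Type*} [NormedAddCommGroup E] [NormedSpace ℝ E]
  {H : Type*} [TopologicalSpace H] {I : ModelWithCorners ℝ E H}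
  {M : Type*} [TopologicalSpace M] [ChartedSpace H M]
  {F : Type*} [NormedAddCommGroup F] [NormedSpace ℝ F]
  {V : M → Type*} [TopologicalSpace (TotalSpace F V)]
  [∀ x, AddCommGroup (V x)] [∀ x, Module ℝ (V x)] [∀ x, TopologicalSpace (V x)]
  [FiberBundle F V]

/-! ### Uniqueness of derivations -/

section ListForms

variable {W : Type*}

/-- A function supported on the empty list is a scalar, and wedging with it is multiplication. -/
theorem listWedge_of_cons_eq_zero (l : List W) : ∀ φ ψ : List W → ℝ,
    (∀ x m, φ (x :: m) = 0) → listWedge φ ψ l = φ [] * ψ l := by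
  induction l with
  | nil => intros; rfl
  | cons x l ih =>
    intro φ ψ h
    rw [listWedge, show (fun m => φ (x :: m)) = 0 from funext fun m => h x m,
      listWedge_zero_left, ih _ _ fun y m => by simp [h]]
    simp

theorem listAlt_sum {ι : Type*} (s : Finset ι) (a : ι → W → List W → ℝ) (l : List W) :
    listAlt (∑ k ∈ s, a k) l = ∑ k ∈ s, listAlt (a k) l :=
  map_sum (AddMonoidHom.mk' (fun a => listAlt a l) (listAlt_add l)) a s

/-- This is Euler's identity `∑ e^k ∧ i_{e_k} η = (deg η) η` without a choice of basis. -/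
theorem listAlt_altList_cons [AddCommGroup W] [Module ℝ W] {p : ℕ}
    (η : W [⋀^Fin (p + 1)]→ₗ[ℝ] ℝ) (l : List W) :
    listAlt (fun y m => altList η (y :: m)) l = (p + 1) * altList η l := by
  have h := altList_alternatizeUncurryFin l (AlternatingMap.curryLeft η)
  rw [AlternatingMap.alternatizeUncurryFin_curryLeft, ← Nat.cast_smul_eq_nsmul ℝ, altList_smul] at h
  simp only [altList_succ_cons]
  rw [← h]
  simp

end ListForms

/-- The value of a form at a point, as a function on lists. -/
def formList {p : ℕ} (x : M) : EForm I F V p →ₗ[ℝ] List (V x) → ℝ where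
  toFun η := altList (η.1 x)
  map_add' η η' := altList_add (η.1 x) (η'.1 x)
  map_smul' c η := altList_smul c (η.1 x)

theorem formList_ext {p : ℕ} {η η' : EForm I F V p} (h : ∀ x, formList x η = formList x η') :
    η = η' :=
  Subtype.ext (funext fun x => altList_injective (h x))

theorem formList_castDeg {p k : ℕ} (h : p = k) (η : EForm I F V p) (x : M) :
    formList x (castDeg h η) = formList x η :=
  altList_domDomCongr h (η.1 x)

theorem formList_wedge {p k : ℕ} (α : EForm I F V p) (β : EForm I F V k) (x : M) :
    formList x (wedge α β) = listWedge (formList x α) (formList x β) :=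
  altList_wedgeAlt (α.1 x) (β.1 x)

/-- The degrees `p + (k + 1)` and `p + k + 1` agree definitionally but not syntactically, and this
version matches the degree occurring in the Leibniz rules. -/
theorem formList_wedge_succ {p k : ℕ} (α : EForm I F V p) (β : EForm I F V (k + 1)) (x : M) :
    formList (p := p + k + 1) x (wedge α β : EForm I F V (p + (k + 1))) =
      listWedge (formList x α) (formList x β) :=
  formList_wedge α β x

theorem listWedge_formList_ofFunction (f : C^∞⟮I, M; ℝ⟯) (x : M) (ψ : List (V x) → ℝ)
    (l : List (V x)) :
    listWedge (formList x (ofFunction f : EForm I F V 0)) ψ l = f x * ψ l :=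
  listWedge_of_cons_eq_zero l (formList x (ofFunction f : EForm I F V 0)) ψ
    (altList_deg_zero_cons ((ofFunction f : EForm I F V 0).1 x))

theorem formList_ofFunction_wedge {p : ℕ} (f : C^∞⟮I, M; ℝ⟯) (η : EForm I F V p) (x : M) :
    formList x (castDeg (zero_add p) (wedge (ofFunction f) η)) = f x • formList x η := by
  ext l
  rw [formList_castDeg, formList_wedge]
  exact listWedge_formList_ofFunction f x _ l

theorem DerivationOne.formList_castDeg (D : DerivationOne I F V) {p k : ℕ} (h : p = k)
    (η : EForm I F V p) (x : M) :
    formList x (D.toFun k (castDeg h η)) = formList x (D.toFun p η) := by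
  subst h; rfl

theorem DerivationOne.formList_wedge (D : DerivationOne I F V) {p k : ℕ} (α : EForm I F V p)
    (β : EForm I F V k) (x : M) :
    formList x (D.toFun (p + k) (wedge α β)) =
      listWedge (formList x (D.toFun p α)) (formList x β) +
        (-1 : ℝ) ^ p • listWedge (formList x α) (formList x (D.toFun k β)) := by
  rw [D.leibniz, map_add, map_smul, LieAlgd.formList_castDeg, LieAlgd.formList_wedge,
    formList_wedge_succ]

/-- The interior product of a form and a section. -/
def contract {p : ℕ} (A : Cₛ^∞⟮I; F, V⟯) (η : EForm I F V (p + 1)) : EForm I F V p :=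
  ⟨fun x => (η.1 x).curryLeft (A x), fun B => by
    convert (evalForm η (Matrix.vecCons A B)).contMDiff using 2 with x
    refine congrArg (η.1 x) ?_
    ext k
    refine Fin.cases ?_ (fun k => ?_) k <;> rfl⟩

theorem formList_contract {p : ℕ} (A : Cₛ^∞⟮I; F, V⟯) (η : EForm I F V (p + 1)) (x : M) :
    formList x (contract A η) = fun l => formList x η (A x :: l) :=
  funext fun l => (altList_succ_cons (η.1 x) (A x) l).symm

theorem eq_ofFunction (η : EForm I F V 0) : η = ofFunction (evalForm η ![]) := by
  refine Subtype.ext (funext fun x => ?_)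
  ext v
  refine congrArg (η.1 x) (Subsingleton.elim _ _)

/-- If `∑ₖ θₖ(b) eₖ = ρ b`, then `∑ₖ θₖ ∧ i_{eₖ} η = (deg η) ρ η`. -/
theorem sum_wedge_contract {r : ℕ} {e : Fin r → Cₛ^∞⟮I; F, V⟯} {θ : Fin r → EForm I F V 1}
    {ρ : C^∞⟮I, M; ℝ⟯} (h : ∀ y (b : V y), ∑ k, (θ k).1 y (fun _ => b) • e k y = ρ y • b)
    {p : ℕ} (η : EForm I F V (p + 1)) :
    ∑ k, castDeg (add_comm 1 p) (wedge (θ k) (contract (e k) η)) =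
      ((p : ℝ) + 1) • castDeg (zero_add (p + 1)) (wedge (ofFunction ρ) η) := by
  refine formList_ext fun x => ?_
  rw [map_smul, formList_ofFunction_wedge]
  simp only [map_sum, formList_castDeg, formList_wedge, formList_contract]
  ext l
  have h1 : ∀ k, listWedge (formList x (θ k)) (fun l => formList x η (e k x :: l)) l =
      listAlt (fun y m => (θ k).1 x (fun _ => y) * formList x η (e k x :: m)) l := by
    intro k
    -- Writing the 1-form as an alternating sum of 0-forms lets `listAlt_wedge_left` turn the wedge
    -- product into a multiplication by scalars.
    have h2 : formList x (θ k) = listAlt fun y m => altList ((θ k).1 x) (y :: m) := by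
      ext l
      rw [listAlt_altList_cons]
      simp [formList]
    rw [h2, ← listAlt_wedge_left]
    congr 1
    ext y m
    rw [listWedge_of_cons_eq_zero _ _ _ fun z m => by simp [altList]]
    congr 1
    simp only [altList, List.length_singleton, if_true]
    congr 1
    ext i
    rw [Subsingleton.elim i 0]
    rfl
  have h3 : ∑ k, (fun (y : V x) (m : List (V x)) =>
      (θ k).1 x (fun _ => y) * formList x η (e k x :: m)) =
      ρ x • fun y m => altList (η.1 x) (y :: m) := by
    ext y m
    have h4 : ∀ b, formList x η (b :: m) = altList ((η.1 x).curryLeft b) m :=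
      fun b => altList_succ_cons (η.1 x) b m
    have h5 : ∀ (c : ℝ) b, c * altList ((η.1 x).curryLeft b) m =
        altList ((η.1 x).curryLeft (c • b)) m := by
      intro c b
      rw [map_smul, altList_smul]; rfl
    let T : V x →+ ℝ := AddMonoidHom.mk' (fun b => altList ((η.1 x).curryLeft b) m) fun b b' => by
      rw [map_add, altList_add]; rfl
    simp only [Finset.sum_apply, Pi.smul_apply, smul_eq_mul, altList_succ_cons, h4, h5, ← h]
    exact (map_sum T _ _).symm
  simp only [Finset.sum_apply, h1, Pi.smul_apply, smul_eq_mul]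
  rw [← listAlt_sum, h3, listAlt_smul, listAlt_altList_cons]
  simp only [formList, LinearMap.coe_mk, AddHom.coe_mk]
  ring

variable [VectorBundle ℝ F V] [IsManifold I ∞ M] [ContMDiffVectorBundle ∞ F V I]
  [FiniteDimensional ℝ E] [FiniteDimensional ℝ F] [T2Space M]

variable (I F V) in
/-- Smooth sections `eₖ` and forms `θₖ` of degree `1` on `M` which, up to a function with value `1`
at `x`, are a frame and its dual frame. -/
theorem exists_frame (x : M) : ∃ (r : ℕ) (e : Fin r → Cₛ^∞⟮I; F, V⟯) (θ : Fin r → EForm I F V 1)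
    (ρ : C^∞⟮I, M; ℝ⟯), ρ x = 1 ∧
      ∀ y (b : V y), ∑ k, (θ k).1 y (fun _ => b) • e k y = ρ y • b := by
  have : ContMDiffVectorBundle 1 F V I := ContMDiffVectorBundle.of_le (n := ∞) (by simp)
  let t := trivializationAt F V x
  let b := Module.finBasis ℝ F
  have hx : x ∈ t.baseSet := FiberBundle.mem_baseSet_trivializationAt' x
  obtain ⟨f, -, hf⟩ := (SmoothBumpFunction.nhds_basis_tsupport (I := I) x).mem_iff.1
    (t.open_baseSet.mem_nhds hx)
  -- Frame and dual frame are each multiplied by the bump function `f`, which makes both global and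
  -- smooth; hence `ρ = f * f`. Off the base set `f` vanishes, so the values of the local frame
  -- there do not matter.
  refine ⟨_, fun k => ⟨(f : M → ℝ) • t.localFrame b k,
    ContMDiffOn.smul_section_of_tsupport f.contMDiff.contMDiffOn t.open_baseSet hf
      (t.contMDiffOn_localFrame_baseSet (I := I) ∞ b k)⟩,
    fun k => ⟨fun y => AlternatingMap.ofSubsingleton ℝ (V y) ℝ (0 : Fin 1)
      (f y • t.localFrameCoeff I b k y), fun A => ?_⟩,
    ⟨fun y => f y * f y, f.contMDiff.mul f.contMDiff⟩, ?_, fun y v => ?_⟩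
  · refine contMDiff_of_tsupport fun y hy => ?_
    have hy' : y ∈ t.baseSet := hf (tsupport_mul_subset_left hy)
    exact f.contMDiffAt.mul (contMDiffAt_localFrameCoeff b hy' (A 0).contMDiff.contMDiffAt k)
  · simp
  · by_cases hy : y ∈ t.baseSet
    · have h := t.eq_sum_localFrameCoeff_smul (I := I) (b := b) hy (s := FiberBundle.extend F v)
      rw [FiberBundle.extend_apply_self] at h
      conv_rhs => rw [h, Finset.smul_sum]
      refine Finset.sum_congr rfl fun k _ => ?_
      simp only [AlternatingMap.ofSubsingleton_apply_apply, LinearMap.smul_apply, smul_eq_mul,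
        ContMDiffSection.coeFn_mk, Pi.smul_apply', ContMDiffMap.coeFn_mk, smul_smul]
      congr 1
      ring
    · have : f y = 0 := image_eq_zero_of_notMem_tsupport fun h => hy (hf h)
      simp [this]

/-- Applied to `∑ θ_k ∧ i_{e_k} η = (p + 1) ρ η`, a derivation gives on the left only its values on
1-forms and in degree `p`, and on the right `(p + 1) (Dρ ∧ η + ρ Dη)`, where `ρ x = 1`. -/
theorem DerivationOne.ext_of_deg_le_one {D D' : DerivationOne I F V}
    (h0 : ∀ f : C^∞⟮I, M; ℝ⟯, D.toFun 0 (ofFunction f) = D'.toFun 0 (ofFunction f))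
    (h1 : ∀ α, D.toFun 1 α = D'.toFun 1 α) : D = D' := by
  have key : ∀ p (η : EForm I F V p), D.toFun p η = D'.toFun p η := by
    intro p
    induction p with
    | zero => intro η; rw [eq_ofFunction η, h0]
    | succ p ih =>
      intro η
      refine formList_ext fun x => ?_
      obtain ⟨r, e, θ, ρ, hρ, he⟩ := exists_frame I F V x
      have h := sum_wedge_contract he η
      have hD := congrArg (fun ζ => formList x (D.toFun (p + 1) ζ)) h
      have hD' := congrArg (fun ζ => formList x (D'.toFun (p + 1) ζ)) h
      simp only [map_sum, map_smul, DerivationOne.formList_castDeg, DerivationOne.formList_wedge,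
        h0, h1, ih] at hD hD'
      rw [hD] at hD'
      have hp : (p : ℝ) + 1 ≠ 0 := by positivity
      -- The terms `Dρ ∧ η` are equal since both derivations agree on functions.
      have h2 := add_left_cancel (smul_right_injective _ hp hD')
      ext l
      have h3 := congrFun h2 l
      simp only [pow_zero, one_smul] at h3
      rwa [listWedge_formList_ofFunction, listWedge_formList_ofFunction, hρ, one_mul,
        one_mul] at h3
  cases D; cases D'
  congr
  ext p η : 2
  exact key p η

end Uniqueness

section Derivation

variable {E : Type*} [NormedAddCommGroup E] [NormedSpace ℝ E]
  {H : Type*} [TopologicalSpace H] {I : ModelWithCorners ℝ E H}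
  {M : Type*} [TopologicalSpace M] [ChartedSpace H M]
  {F : Type*} [NormedAddCommGroup F] [NormedSpace ℝ F]
  {V : M → Type*} [TopologicalSpace (TotalSpace F V)]
  [∀ x, AddCommGroup (V x)] [∀ x, Module ℝ (V x)] [∀ x, TopologicalSpace (V x)]
  [FiberBundle F V]

/-! ### The derivation `∇_q + ι_L` -/

variable [VectorBundle ℝ F V] [IsManifold I ∞ M]

theorem mvfderiv_sum {ι : Type} (s : Finset ι) {f : ι → M → ℝ} {x : M}
    (hf : ∀ i, MDifferentiableAt I 𝓘(ℝ, ℝ) (f i) x) :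
    mvfderiv I (∑ i ∈ s, f i) x = ∑ i ∈ s, mvfderiv I (f i) x := by
  classical
  induction s using Finset.induction_on with
  | empty => simp
  | insert a s ha ih =>
    have hs : MDifferentiableAt I 𝓘(ℝ, ℝ) (∑ i ∈ s, f i) x :=
      MDifferentiableAt.sum fun i _ => hf i
    rw [Finset.sum_insert ha, Finset.sum_insert ha, mvfderiv_add (hf a) hs, ih]

variable [∀ x, IsTopologicalAddGroup (V x)] [∀ x, ContinuousSMul ℝ (V x)]
  [ContMDiffVectorBundle ∞ F V I] [FiniteDimensional ℝ E] [FiniteDimensional ℝ F] [T2Space M]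

theorem exists_section_apply_eq (x : M) (b : V x) : ∃ A : Cₛ^∞⟮I; F, V⟯, A x = b := by
  obtain ⟨r, e, θ, ρ, hρ, he⟩ := exists_frame I F V x
  refine ⟨∑ k, (θ k).1 x (fun _ => b) • e k, ?_⟩
  have h := he x b
  rw [hρ, one_smul] at h
  conv_rhs => rw [← h]
  let T : Cₛ^∞⟮I; F, V⟯ →+ V x := AddMonoidHom.mk' (fun A => A x) fun _ _ => rfl
  exact map_sum T _ _

/-- With representatives of the shuffles fixed, each summand is a product of two functions, so the
product rule applies. In the correction terms the differentiated section is an argument of exactly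
one of the two factors. -/
theorem covFormAux_wedge (cov : CovariantDerivative I F V) {p k : ℕ} (α : EForm I F V p)
    (β : EForm I F V k) (x : M) (v : TangentSpace I x) (B : Fin (p + k) → Cₛ^∞⟮I; F, V⟯) :
    covFormAux cov (wedge α β) x v (fun i => B i) =
      ∑ σ : Equiv.Perm.ModSumCongr (Fin p) (Fin k), (Equiv.Perm.sign σ.out : ℤ) *
        (covFormAux cov α x v (fun i => B (finSumFinEquiv (σ.out (Sum.inl i)))) *
            β.1 x (fun j => B (finSumFinEquiv (σ.out (Sum.inr j))) x) +
          α.1 x (fun i => B (finSumFinEquiv (σ.out (Sum.inl i))) x) *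
            covFormAux cov β x v (fun j => B (finSumFinEquiv (σ.out (Sum.inr j))))) := by
  set a : Equiv.Perm.ModSumCongr (Fin p) (Fin k) → M → ℝ := fun σ y =>
    α.1 y fun i => B (finSumFinEquiv (σ.out (Sum.inl i))) y with ha
  set b : Equiv.Perm.ModSumCongr (Fin p) (Fin k) → M → ℝ := fun σ y =>
    β.1 y fun j => B (finSumFinEquiv (σ.out (Sum.inr j))) y with hb
  have had : ∀ σ, MDifferentiableAt I 𝓘(ℝ, ℝ) (a σ) x := fun σ =>
    (α.2 fun i => B (finSumFinEquiv (σ.out (Sum.inl i)))).mdifferentiableAt (by simp)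
  have hbd : ∀ σ, MDifferentiableAt I 𝓘(ℝ, ℝ) (b σ) x := fun σ =>
    (β.2 fun i => B (finSumFinEquiv (σ.out (Sum.inr i)))).mdifferentiableAt (by simp)
  have hd : mvfderiv I (fun y => (wedge α β).1 y fun i => B i y) x v =
      ∑ σ : Equiv.Perm.ModSumCongr (Fin p) (Fin k), (Equiv.Perm.sign σ.out : ℤ) *
        (mvfderiv I (a σ) x v * b σ x + a σ x * mvfderiv I (b σ) x v) := by
    have e : (fun y => (wedge α β).1 y fun i => B i y) =
        ∑ σ, (fun _ => ((Equiv.Perm.sign (Quotient.out σ) : ℤ) : ℝ)) * (a σ * b σ) := by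
      ext y
      simp only [wedge, wedgeAlt_apply, Finset.sum_apply, Pi.mul_apply, zsmul_eq_mul]
      rfl
    rw [e, mvfderiv_sum]
    · rw [sum_apply]
      refine Finset.sum_congr rfl fun σ _ => ?_
      rw [mvfderiv_mul mdifferentiableAt_const ((had σ).mul (hbd σ)), mvfderiv_mul (had σ) (hbd σ),
        mvfderiv_const]
      simp
      ring
    · exact fun σ => mdifferentiableAt_const.mul ((had σ).mul (hbd σ))
  have hs : ∑ j, (wedge α β).1 x (update (fun i => B i x) j (cov (B j) x v)) =
      ∑ σ : Equiv.Perm.ModSumCongr (Fin p) (Fin k), (Equiv.Perm.sign σ.out : ℤ) *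
        ((∑ i, α.1 x (update (fun i => B (finSumFinEquiv (σ.out (Sum.inl i))) x) i
            (cov (B (finSumFinEquiv (σ.out (Sum.inl i)))) x v))) * b σ x +
          a σ x * ∑ j, β.1 x (update (fun j => B (finSumFinEquiv (σ.out (Sum.inr j))) x) j
            (cov (B (finSumFinEquiv (σ.out (Sum.inr j)))) x v))) := by
    simp only [wedge, wedgeAlt_apply]
    rw [Finset.sum_comm]
    refine Finset.sum_congr rfl fun σ _ => ?_
    -- Reindexing by the shuffle sorts the slots into those feeding `α` and those feeding `β`.
    rw [← (σ.out.trans finSumFinEquiv).sum_comp, Fintype.sum_sum_type, mul_add, Finset.sum_mul,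
      Finset.mul_sum, Finset.mul_sum, Finset.mul_sum]
    congr 1
    · refine Finset.sum_congr rfl fun i _ => ?_
      rw [zsmul_eq_mul]
      congr 2
      · refine congrArg (α.1 x) ?_
        ext i'
        by_cases h : i' = i
        · subst h; simp
        · simp [h]
      · simp [hb]
    · refine Finset.sum_congr rfl fun i _ => ?_
      rw [zsmul_eq_mul]
      congr 2
      · simp [ha]
      · refine congrArg (β.1 x) ?_
        ext i'
        by_cases h : i' = i
        · subst h; simp
        · simp [h]
  rw [covFormAux, hd, hs, ← Finset.sum_sub_distrib]
  refine Finset.sum_congr rfl fun σ _ => ?_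
  simp only [covFormAux, ha, hb]
  ring

theorem covForm_wedge (cov : CovariantDerivative I F V) {p k : ℕ} (α : EForm I F V p)
    (β : EForm I F V k) (x : M) (v : TangentSpace I x) :
    covForm cov (wedge α β) x v =
      wedgeAlt (covForm cov α x v) (β.1 x) + wedgeAlt (α.1 x) (covForm cov β x v) := by
  ext b
  choose B hB using fun i => exists_section_apply_eq (I := I) (F := F) x (b i)
  obtain rfl : (fun i => B i x) = b := funext hB
  rw [covForm_apply, covFormAux_wedge, AlternatingMap.add_apply, wedgeAlt_apply, wedgeAlt_apply,
    ← Finset.sum_add_distrib]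
  refine Finset.sum_congr rfl fun σ _ => ?_
  rw [covForm_apply cov α x v fun i => B (finSumFinEquiv (σ.out (Sum.inl i))),
    covForm_apply cov β x v fun i => B (finSumFinEquiv (σ.out (Sum.inr i)))]
  simp only [zsmul_eq_mul]
  ring

theorem covForm_add (cov : CovariantDerivative I F V) {p : ℕ} (η η' : EForm I F V p) (x : M)
    (v : TangentSpace I x) :
    covForm cov (η + η') x v = covForm cov η x v + covForm cov η' x v := by
  ext b
  choose B hB using fun i => exists_section_apply_eq (I := I) (F := F) x (b i)
  obtain rfl : (fun i => B i x) = b := funext hB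
  rw [AlternatingMap.add_apply, covForm_apply, covForm_apply, covForm_apply]
  have h := mvfderiv_add ((η.2 B).mdifferentiableAt (x := x) (by simp))
    ((η'.2 B).mdifferentiableAt (x := x) (by simp))
  have h' := congrArg (fun L => L v) h
  simp only [covFormAux]
  refine Eq.trans (congrArg₂ (· - ·) h' Finset.sum_add_distrib) ?_
  simp only [add_apply, AlternatingMap.coe_multilinearMap]
  ring

theorem covForm_smul (cov : CovariantDerivative I F V) {p : ℕ} (c : ℝ) (η : EForm I F V p) (x : M)
    (v : TangentSpace I x) :
    covForm cov (c • η) x v = c • covForm cov η x v := by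
  ext b
  choose B hB using fun i => exists_section_apply_eq (I := I) (F := F) x (b i)
  obtain rfl : (fun i => B i x) = b := funext hB
  rw [AlternatingMap.smul_apply, covForm_apply, covForm_apply]
  have h := mvfderiv_mul (mdifferentiableAt_const (c := c))
    ((η.2 B).mdifferentiableAt (x := x) (by simp))
  rw [mvfderiv_const] at h
  have h' := congrArg (fun L => L v) h
  simp only [covFormAux]
  refine Eq.trans (congrArg₂ (· - ·) h' (Finset.mul_sum _ _ c).symm) ?_
  simp
  ring

theorem formList_nablaForm (cov : CovariantDerivative I F V) [cov.ContMDiffCovariantDerivative ∞]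
    (q : BundleMapToTangent I F V) {p : ℕ} (η : EForm I F V p) (x : M) :
    formList x (nablaForm cov q η) =
      listAlt fun y => altList (covForm cov η x (q.toFun x y)) :=
  funext fun l => altList_alternatizeUncurryFin l _

theorem formList_insertion (L : EValuedForm I F V 2) {p : ℕ} (η : EForm I F V p) (x : M) :
    formList x (insertion L η) = (1 / 2 : ℝ) • listAlt fun a => listAlt fun b m =>
      formList x η (L.toFun x ![a, b] :: m) := by
  cases p <;> exact altList_insertAlt (L.toFun x) (η.1 x)

theorem nablaForm_add (cov : CovariantDerivative I F V) [cov.ContMDiffCovariantDerivative ∞]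
    (q : BundleMapToTangent I F V) {p : ℕ} (η η' : EForm I F V p) :
    nablaForm cov q (η + η') = nablaForm cov q η + nablaForm cov q η' := by
  refine formList_ext fun x => funext fun l => ?_
  simp only [map_add, formList_nablaForm, covForm_add, altList_add]
  exact listAlt_add l _ _

theorem nablaForm_smul (cov : CovariantDerivative I F V) [cov.ContMDiffCovariantDerivative ∞]
    (q : BundleMapToTangent I F V) {p : ℕ} (c : ℝ) (η : EForm I F V p) :
    nablaForm cov q (c • η) = c • nablaForm cov q η := by
  refine formList_ext fun x => funext fun l => ?_
  simp only [map_smul, formList_nablaForm, covForm_smul, altList_smul]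
  exact listAlt_smul c l _

/-- `∇_v` is a derivation without signs; the sign `(-1)^p` arises only when the argument `v = q y`
is alternated past `α`. -/
theorem nablaForm_wedge (cov : CovariantDerivative I F V) [cov.ContMDiffCovariantDerivative ∞]
    (q : BundleMapToTangent I F V) {p k : ℕ} (α : EForm I F V p) (β : EForm I F V k) :
    nablaForm cov q (wedge α β) =
      castDeg (Nat.add_right_comm p 1 k) (wedge (nablaForm cov q α) β) +
        (-1 : ℝ) ^ p • wedge α (nablaForm cov q β) := by
  refine formList_ext fun x => funext fun l => ?_
  rw [map_add, map_smul, formList_castDeg, formList_wedge, formList_wedge_succ]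
  simp only [formList_nablaForm, covForm_wedge, altList_add, altList_wedgeAlt]
  refine (listAlt_add l (fun y => listWedge (altList (covForm cov α x (q.toFun x y)))
    (altList (β.1 x))) fun y => listWedge (altList (α.1 x))
    (altList (covForm cov β x (q.toFun x y)))).trans ?_
  rw [listAlt_wedge_left, listAlt_wedge_right, neg_one_pow_length_altList, listWedge_smul_left]
  rfl

theorem insertion_add (L : EValuedForm I F V 2) {p : ℕ} (η η' : EForm I F V p) :
    insertion L (η + η') = insertion L η + insertion L η' := by
  refine formList_ext fun x => funext fun l => ?_
  simp only [map_add, formList_insertion, Pi.add_apply, Pi.smul_apply, smul_eq_mul]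
  rw [← mul_add, ← listAlt_add]
  refine congrArg (fun a => 1 / 2 * listAlt a l) ?_
  ext a m
  exact listAlt_add m _ _

theorem insertion_smul (L : EValuedForm I F V 2) {p : ℕ} (c : ℝ) (η : EForm I F V p) :
    insertion L (c • η) = c • insertion L η := by
  refine formList_ext fun x => funext fun l => ?_
  simp only [map_smul, formList_insertion, Pi.smul_apply, smul_eq_mul]
  rw [mul_left_comm c, ← listAlt_smul c]
  refine congrArg (fun a => 1 / 2 * listAlt a l) ?_
  ext a m
  exact listAlt_smul c m _

theorem insertion_wedge (L : EValuedForm I F V 2) {p k : ℕ} (α : EForm I F V p)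
    (β : EForm I F V k) :
    insertion L (wedge α β) =
      castDeg (Nat.add_right_comm p 1 k) (wedge (insertion L α) β) +
        (-1 : ℝ) ^ p • wedge α (insertion L β) := by
  refine formList_ext fun x => funext fun l => ?_
  rw [map_add, map_smul, formList_castDeg, formList_wedge, formList_wedge_succ]
  -- Contraction with `L(a, b)` and alternation in `b` each contribute a parity twist on `α`, and
  -- the two cancel. The alternation in `a` then produces the single sign `(-1)^p`.
  have h1 : ∀ a : V x, (listAlt fun b m =>
      listWedge (formList x α) (formList x β) (L.toFun x ![a, b] :: m)) =
      listWedge (listAlt fun b m => formList x α (L.toFun x ![a, b] :: m)) (formList x β) +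
        listWedge (formList x α) (listAlt fun b m => formList x β (L.toFun x ![a, b] :: m)) := by
    intro a
    ext l
    refine (listAlt_add l (fun b => listWedge (fun m => formList x α (L.toFun x ![a, b] :: m))
      (formList x β)) fun b => listWedge (fun m => (-1) ^ m.length * formList x α m)
      fun m => formList x β (L.toFun x ![a, b] :: m)).trans ?_
    rw [listAlt_wedge_left, listAlt_wedge_right, neg_one_pow_length_twice]
    rfl
  simp only [formList_insertion, formList_wedge, Pi.smul_apply, Pi.add_apply, smul_eq_mul, h1,
    listWedge_smul_left, listWedge_smul_right]
  have h2 := listAlt_add l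
    (fun a => listWedge (listAlt fun b m => formList x α (L.toFun x ![a, b] :: m)) (formList x β))
    (fun a => listWedge (formList x α) (listAlt fun b m => formList x β (L.toFun x ![a, b] :: m)))
  have h3 : (fun m => (-1) ^ m.length * formList x α m) = (-1 : ℝ) ^ p • formList x α :=
    neg_one_pow_length_altList (α.1 x)
  rw [listAlt_wedge_left, listAlt_wedge_right, h3, listWedge_smul_left] at h2
  refine (congrArg (fun c : ℝ => 1 / 2 * c) h2).trans ?_
  ring

/-- The derivation `∇_q + ι_L`. -/
def nablaAddInsertion (cov : CovariantDerivative I F V) [cov.ContMDiffCovariantDerivative ∞]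
    (q : BundleMapToTangent I F V) (L : EValuedForm I F V 2) : DerivationOne I F V where
  toFun p :=
    { toFun := fun η => nablaForm cov q η + insertion L η
      map_add' := fun η η' => by rw [nablaForm_add, insertion_add]; abel
      map_smul' := fun c η => by rw [nablaForm_smul, insertion_smul, RingHom.id_apply, smul_add] }
  leibniz p k α β := by
    simp only [LinearMap.coe_mk, AddHom.coe_mk, nablaForm_wedge, insertion_wedge]
    refine formList_ext fun x => funext fun l => ?_
    rw [map_add, map_add, map_add, map_add, map_smul, map_smul, map_smul, formList_wedge_succ,
      formList_wedge_succ, formList_wedge_succ]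
    simp only [map_add, formList_castDeg, formList_wedge, Pi.add_apply, Pi.smul_apply,
      listWedge_add_left, listWedge_add_right, smul_eq_mul]
    ring

end Derivation

section TorsionTensor

variable {E : Type*} [NormedAddCommGroup E] [NormedSpace ℝ E]
  {H : Type*} [TopologicalSpace H] {I : ModelWithCorners ℝ E H}
  {M : Type*} [TopologicalSpace M] [ChartedSpace H M]
  {F : Type*} [NormedAddCommGroup F] [NormedSpace ℝ F]
  {V : M → Type*} [TopologicalSpace (TotalSpace F V)]
  [∀ x, AddCommGroup (V x)] [∀ x, Module ℝ (V x)] [∀ x, TopologicalSpace (V x)]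
  [FiberBundle F V]

/-! ### The torsion as a tensor field -/

variable [VectorBundle ℝ F V] [IsManifold I ∞ M]

section Torsion

variable {𝔞 : LieAlgebroid I F V}

theorem LieAlgebroid.bracket_swap (𝔞 : LieAlgebroid I F V) (A B : Cₛ^∞⟮I; F, V⟯) :
    𝔞.bracket A B = -𝔞.bracket B A := by
  have h := 𝔞.bracket_self (A + B)
  simp only [map_add, LinearMap.add_apply, 𝔞.bracket_self, zero_add, add_zero] at h
  exact eq_neg_of_add_eq_zero_left (by rw [← h]; abel)

theorem EConnection.torsion_swap (δ : EConnection 𝔞) (A B : Cₛ^∞⟮I; F, V⟯) :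
    δ.torsion A B = -δ.torsion B A := by
  rw [torsion, torsion, 𝔞.bracket_swap A B]; abel

theorem EConnection.torsion_self (δ : EConnection 𝔞) (A : Cₛ^∞⟮I; F, V⟯) : δ.torsion A A = 0 := by
  rw [torsion, 𝔞.bracket_self]; abel

/-- The torsion as an `ℝ`-bilinear map. -/
def EConnection.torsionLM (δ : EConnection 𝔞) :
    Cₛ^∞⟮I; F, V⟯ →ₗ[ℝ] Cₛ^∞⟮I; F, V⟯ →ₗ[ℝ] Cₛ^∞⟮I; F, V⟯ :=
  δ.toFun - δ.toFun.flip - 𝔞.bracket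

theorem EConnection.torsionLM_apply (δ : EConnection 𝔞) (A B : Cₛ^∞⟮I; F, V⟯) :
    δ.torsionLM A B = δ.torsion A B := rfl

/-- Both `δ_A (fB)` and `[A, fB]` contain the term `qA(f) B`, and they enter with opposite signs. -/
theorem EConnection.torsionLM_fmul_right (δ : EConnection 𝔞) (A B : Cₛ^∞⟮I; F, V⟯)
    (f : C^∞⟮I, M; ℝ⟯) : δ.torsionLM A (fmul f B) = fmul f (δ.torsionLM A B) := by
  ext x
  have h1 := δ.leibniz A B f x
  have h2 := 𝔞.leibniz A B f x
  have h3 : δ.toFun (fmul f B) A x = f x • δ.toFun B A x := by rw [δ.fmul_left]; rfl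
  change δ.toFun A (fmul f B) x - δ.toFun (fmul f B) A x - 𝔞.bracket A (fmul f B) x =
    f x • (δ.toFun A B x - δ.toFun B A x - 𝔞.bracket A B x)
  rw [h1, h2, h3]
  module

theorem EConnection.torsionLM_fmul_left (δ : EConnection 𝔞) (A B : Cₛ^∞⟮I; F, V⟯)
    (f : C^∞⟮I, M; ℝ⟯) : δ.torsionLM (fmul f A) B = fmul f (δ.torsionLM A B) := by
  rw [torsionLM_apply, torsion_swap, ← torsionLM_apply, torsionLM_fmul_right, torsionLM_apply,
    torsionLM_apply, torsion_swap δ A B]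
  ext x
  exact (smul_neg _ _).symm

variable [∀ x, IsTopologicalAddGroup (V x)] [∀ x, ContinuousSMul ℝ (V x)]
  [ContMDiffVectorBundle ∞ F V I] [FiniteDimensional ℝ E] [FiniteDimensional ℝ F] [T2Space M]

/-- The value at `x` of a form of degree `1`, as a linear map. -/
def oneFormAt (α : EForm I F V 1) (x : M) : V x →ₗ[ℝ] ℝ where
  toFun b := α.1 x fun _ => b
  map_add' u w := by
    have e : ∀ u : V x, (fun _ => u) = update (0 : Fin 1 → V x) 0 u := fun u => by
      ext i; rw [Subsingleton.elim i 0]; simp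
    simp only [e, AlternatingMap.map_update_add]
  map_smul' c u := by
    have e : ∀ u : V x, (fun _ => u) = update (0 : Fin 1 → V x) 0 u := fun u => by
      ext i; rw [Subsingleton.elim i 0]; simp
    simp only [e, AlternatingMap.map_update_smul, RingHom.id_apply]

/-- The value of a section at a point. -/
def sectionEval (x : M) : Cₛ^∞⟮I; F, V⟯ →ₗ[ℝ] V x where
  toFun A := A x
  map_add' _ _ := rfl
  map_smul' _ _ := rfl

variable (I F V) in
/-- A linear choice of smooth sections with a given value at a point. -/
theorem exists_linear_section (x : M) : ∃ s : V x →ₗ[ℝ] Cₛ^∞⟮I; F, V⟯,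
    (∀ b, s b x = b) ∧ ∀ T : Cₛ^∞⟮I; F, V⟯ →ₗ[ℝ] Cₛ^∞⟮I; F, V⟯,
      (∀ (f : C^∞⟮I, M; ℝ⟯) A, T (fmul f A) = fmul f (T A)) → ∀ A, T (s (A x)) x = T A x := by
  obtain ⟨r, e, θ, ρ, hρ, he⟩ := exists_frame I F V x
  -- The coefficients `θ_k(b)` are constants taken at `x`, so the choice is linear in `b`.
  let s : V x →ₗ[ℝ] Cₛ^∞⟮I; F, V⟯ := ∑ k, (oneFormAt (θ k) x).smulRight (e k)
  have hs : ∀ b, s b = ∑ k, (θ k).1 x (fun _ => b) • e k := fun b => by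
    simp [s, oneFormAt]
  refine ⟨s, fun b => ?_, fun T hT A => ?_⟩
  · have h : sectionEval x (s b) = ∑ k, (θ k).1 x (fun _ => b) • sectionEval x (e k) := by
      simp only [hs, map_sum, map_smul]
    refine h.trans ((he x b).trans ?_)
    rw [hρ, one_smul]
  -- Since `ρ A = ∑ θ_k(A) e_k` globally and `ρ x = 1`, a `C^∞(M)`-linear `T` satisfies `T A x = ∑
  -- θ_k(A x) T e_k x`, which depends on `A x` alone.
  · have h1 : fmul ρ A = ∑ k, fmul (evalForm (θ k) ![A]) (e k) := by
      ext y
      refine (he y (A y)).symm.trans ?_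
      refine Eq.trans ?_ (map_sum (sectionEval y) _ _).symm
      refine Finset.sum_congr rfl fun k _ => congrArg (· • e k y) (congrArg ((θ k).1 y) ?_)
      ext i; rw [Subsingleton.elim i 0]; rfl
    have h2 : sectionEval x (T (fmul ρ A)) = T A x := by
      rw [hT]
      change ρ x • T A x = T A x
      rw [hρ, one_smul]
    have h3 : sectionEval x (T (s (A x))) =
        ∑ k, (θ k).1 x (fun _ => A x) • sectionEval x (T (e k)) := by
      simp only [hs, map_sum, map_smul]
    refine h3.trans (Eq.trans ?_ h2)
    rw [h1, map_sum, map_sum]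
    refine Finset.sum_congr rfl fun k _ => ?_
    rw [hT]
    refine congrArg (· • T (e k) x) (congrArg ((θ k).1 x) ?_)
    ext i; rw [Subsingleton.elim i 0]; rfl

/-- The torsion as a tensor field. -/
theorem EConnection.exists_torsion_tensor (δ : EConnection 𝔞) :
    ∃ L : EValuedForm I F V 2, ∀ A B : Cₛ^∞⟮I; F, V⟯, L.eval ![A, B] = δ.torsion A B := by
  choose s hs hT using fun x => exists_linear_section I F V x
  -- Tensoriality is used in one argument at a time.
  have key : ∀ (A B : Cₛ^∞⟮I; F, V⟯) x, δ.torsionLM (s x (A x)) (s x (B x)) x =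
      δ.torsionLM A B x := by
    intro A B x
    rw [hT x (δ.torsionLM (s x (A x))) fun f B => δ.torsionLM_fmul_right _ B f]
    exact hT x (δ.torsionLM.flip B) (fun f A => δ.torsionLM_fmul_left A B f) A
  let T : ∀ x, V x [⋀^Fin 2]→ₗ[ℝ] V x := fun x =>
    { toFun := fun v => δ.torsionLM (s x (v 0)) (s x (v 1)) x
      map_update_add' := by
        intro inst v i a b
        rw [Subsingleton.elim inst (instDecidableEqFin 2)]
        fin_cases i
        · exact congrFun (congrArg DFunLike.coe (by simp :
            δ.torsionLM (s x (a + b)) (s x (v 1)) =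
              δ.torsionLM (s x a) (s x (v 1)) + δ.torsionLM (s x b) (s x (v 1)))) x
        · exact congrFun (congrArg DFunLike.coe (by simp :
            δ.torsionLM (s x (v 0)) (s x (a + b)) =
              δ.torsionLM (s x (v 0)) (s x a) + δ.torsionLM (s x (v 0)) (s x b))) x
      map_update_smul' := by
        intro inst v i c a
        rw [Subsingleton.elim inst (instDecidableEqFin 2)]
        fin_cases i
        · exact congrFun (congrArg DFunLike.coe (by simp :
            δ.torsionLM (s x (c • a)) (s x (v 1)) = c • δ.torsionLM (s x a) (s x (v 1)))) x
        · exact congrFun (congrArg DFunLike.coe (by simp :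
            δ.torsionLM (s x (v 0)) (s x (c • a)) = c • δ.torsionLM (s x (v 0)) (s x a))) x
      map_eq_zero_of_eq' := by
        intro v i j h hij
        have h01 : v 0 = v 1 := by fin_cases i <;> fin_cases j <;> simp_all
        rw [h01, δ.torsionLM_apply, δ.torsion_self]
        rfl }
  have hsm : ∀ A : Fin 2 → Cₛ^∞⟮I; F, V⟯, ∀ x, T x (fun i => A i x) = δ.torsionLM (A 0) (A 1) x :=
    fun A x => key (A 0) (A 1) x
  refine ⟨⟨T, fun A => ?_⟩, fun A B => ?_⟩
  · simp only [hsm]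
    exact (δ.torsionLM (A 0) (A 1)).contMDiff
  · ext x
    exact hsm ![A, B] x

/-! ### The differential: uniqueness and its realisation as `∇_q + ι_L` -/

theorem LieAlgebroid.IsDifferential.unique {D D' : DerivationOne I F V} (h : 𝔞.IsDifferential D)
    (h' : 𝔞.IsDifferential D') : D = D' := by
  refine DerivationOne.ext_of_deg_le_one (fun f => ?_) fun α => ?_
  · refine Subtype.ext (funext fun x => ?_)
    ext b
    obtain ⟨A, hA⟩ := exists_section_apply_eq (I := I) (F := F) x (b 0)
    have e : b = fun i => ![A] i x := by
      ext i; fin_cases i; exact hA.symm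
    rw [e]
    exact (h.function f A x).trans (h'.function f A x).symm
  · refine Subtype.ext (funext fun x => ?_)
    ext b
    obtain ⟨A, hA⟩ := exists_section_apply_eq (I := I) (F := F) x (b 0)
    obtain ⟨B, hB⟩ := exists_section_apply_eq (I := I) (F := F) x (b 1)
    have e : b = fun i => ![A, B] i x := by
      ext i; fin_cases i
      exacts [hA.symm, hB.symm]
    rw [e]
    exact (h.oneForm α A B x).trans (h'.oneForm α A B x).symm

/-- In degree 1, `∇_q α` contributes `qA(α(B)) - qB(α(A))` together with `-α(∇_{qA} B) + α(∇_{qB}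
A)`. Adding `α(L(A, B))` cancels the connection terms and leaves `-α([A, B])`. In degree 0 the
insertion vanishes and `∇_q f` is `df` composed with the anchor. -/
theorem isDifferential_nablaAddInsertion (cov : CovariantDerivative I F V)
    [cov.ContMDiffCovariantDerivative ∞] {L : EValuedForm I F V 2}
    (hL : ∀ A B, L.eval ![A, B] = (inducedConnection 𝔞 cov).torsion A B) :
    𝔞.IsDifferential (nablaAddInsertion cov 𝔞.anchor L) where
  function f A x := by
    have h : (nablaForm cov 𝔞.anchor (ofFunction f : EForm I F V 0)).1 x (fun i => ![A] i x) =
        covForm cov (ofFunction f : EForm I F V 0) x (𝔞.anchor.toFun x (A x))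
          (fun i : Fin 0 => (![] : Fin 0 → Cₛ^∞⟮I; F, V⟯) i x) := by
      refine (AlternatingMap.alternatizeUncurryFin_apply _ _).trans ?_
      simp
      congr 1
      exact Subsingleton.elim _ _
    have h' : (insertion L (ofFunction f : EForm I F V 0)).1 x (fun i => ![A] i x) = 0 := rfl
    refine (congrArg₂ (· + ·) h h').trans ?_
    rw [covForm_apply]
    simp only [covFormAux, Finset.univ_eq_empty, Finset.sum_empty, sub_zero, add_zero]
    rfl
  oneForm α A B x := by
    have hc : ∀ (v : TangentSpace I x) (C : Cₛ^∞⟮I; F, V⟯), covForm cov α x v (fun _ => C x) =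
        mvfderiv I (evalForm α ![C]) x v - α.1 x (fun _ => cov C x v) := by
      intro v C
      rw [covForm_apply cov α x v fun _ => C]
      simp only [covFormAux, Finset.univ_unique, Finset.sum_singleton]
      refine congrArg₂ (fun (f : M → ℝ) w => mvfderiv I f x v - α.1 x w) ?_ ?_
      · ext y
        refine congrArg (α.1 y) ?_
        ext i; rw [Subsingleton.elim i 0]; rfl
      · ext i; rw [Subsingleton.elim i default]; simp
    have h : (nablaForm cov 𝔞.anchor α).1 x (fun i => ![A, B] i x) =
        covForm cov α x (𝔞.anchor.toFun x (A x)) (fun _ => B x) -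
          covForm cov α x (𝔞.anchor.toFun x (B x)) (fun _ => A x) := by
      refine (AlternatingMap.alternatizeUncurryFin_apply _ _).trans ?_
      rw [Fin.sum_univ_two]
      simp [sub_eq_add_neg]
      congr 2
      · ext i; rw [Subsingleton.elim i 0]; rfl
      · congr 1
        ext i; rw [Subsingleton.elim i 0]; rfl
    have h' : (insertion L α).1 x (fun i => ![A, B] i x) =
        α.1 x (fun _ => cov B x (𝔞.anchor.toFun x (A x)) - cov A x (𝔞.anchor.toFun x (B x))
          - 𝔞.bracket A B x) := by
      refine (insertAlt_apply (L.toFun x) (α.1 x) _).trans ?_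
      have hL' : L.toFun x ![A x, B x] = cov B x (𝔞.anchor.toFun x (A x))
          - cov A x (𝔞.anchor.toFun x (B x)) - 𝔞.bracket A B x := by
        refine Eq.trans ?_ (congrArg (fun C : Cₛ^∞⟮I; F, V⟯ => C x) (hL A B))
        refine congrArg (L.toFun x) ?_
        ext i; fin_cases i <;> rfl
      rw [← hL']
      simp
      congr 1
      ext i; rw [Subsingleton.elim i 0]; rfl
    refine (congrArg₂ (· + ·) h h').trans ?_
    have hl : ∀ u w : V x, α.1 x (fun _ => u - w) = α.1 x (fun _ => u) - α.1 x fun _ => w :=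
      map_sub (oneFormAt α x)
    have hb : evalForm α ![𝔞.bracket A B] x = α.1 x fun _ => 𝔞.bracket A B x := by
      refine congrArg (α.1 x) ?_
      ext i; rw [Subsingleton.elim i 0]; rfl
    simp only [hc, hl, hb, anchorDeriv]
    ring

end Torsion

end TorsionTensor

end LieAlgd

end

theorem mainTheorem11
    {E : Type*} [NormedAddCommGroup E] [NormedSpace ℝ E] [FiniteDimensional ℝ E]
    {H : Type*} [TopologicalSpace H] {I : ModelWithCorners ℝ E H}
    {M : Type*} [TopologicalSpace M] [ChartedSpace H M] [IsManifold I ∞ M]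
    [BoundarylessManifold I M] [T2Space M]
    {F : Type*} [NormedAddCommGroup F] [NormedSpace ℝ F] [FiniteDimensional ℝ F]
    {V : M → Type*} [TopologicalSpace (TotalSpace F V)]
    [∀ x, AddCommGroup (V x)] [∀ x, Module ℝ (V x)] [∀ x, TopologicalSpace (V x)]
    [∀ x, IsTopologicalAddGroup (V x)] [∀ x, ContinuousSMul ℝ (V x)]
    [FiberBundle F V] [VectorBundle ℝ F V] [ContMDiffVectorBundle ∞ F V I]
    (𝔞 : LieAlgd.LieAlgebroid I F V)
    (cov : CovariantDerivative I F V) [cov.ContMDiffCovariantDerivative ∞] :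
    (∃! D : LieAlgd.DerivationOne I F V, 𝔞.IsDifferential D) ∧
    ∃ L : LieAlgd.EValuedForm I F V 2,
      (∀ A B : Cₛ^∞⟮I; F, V⟯,
        L.eval ![A, B] = (LieAlgd.inducedConnection 𝔞 cov).torsion A B) ∧
      (∀ (A B : Cₛ^∞⟮I; F, V⟯) (x : M),
        L.eval ![A, B] x =
          cov B x (𝔞.anchor.toFun x (A x)) - cov A x (𝔞.anchor.toFun x (B x))
            - 𝔞.bracket A B x) ∧
      ∀ D : LieAlgd.DerivationOne I F V, 𝔞.IsDifferential D →
        ∀ (p : ℕ) (η : LieAlgd.EForm I F V p),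
          D.toFun p η = LieAlgd.nablaForm cov 𝔞.anchor η + LieAlgd.insertion L η := by
  obtain ⟨L, hL⟩ := (LieAlgd.inducedConnection 𝔞 cov).exists_torsion_tensor
  have hD := LieAlgd.isDifferential_nablaAddInsertion cov hL
  have huniq : ∀ D : LieAlgd.DerivationOne I F V, 𝔞.IsDifferential D →
      D = LieAlgd.nablaAddInsertion cov 𝔞.anchor L := fun D h => h.unique hD
  -- The witness for existence is `∇_q + ι_L` itself, so the formula for an arbitrary differential
  -- is uniqueness read backwards.
  refine ⟨⟨_, hD, huniq⟩, L, hL, fun A B x => ?_, fun D h p η => ?_⟩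
  · rw [hL]; rfl
  · rw [huniq D h]; rfl
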